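/- Let $\mathbb K$ be $\mathbb R$ or $\mathbb C$; all spaces and algebras are over $\mathbb K$, and $B(X)$ denotes the bounded operators on a Banach space $X$. A Banach algebra dynamical system $(A,G,\alpha)$ consists of a (not necessarily unital) Banach algebra $A$, a locally compact Hausdorff group $G$ with a fixed left Haar measure, and a strongly continuous representation $\alpha$ of $G$ on $A$ by bounded algebra automorphisms. A covariant representation of $(A,G,\alpha)$ on a Banach space $X$ is a pair $(\pi,U)$ of an algebra representation $\pi:A\to B(X)$ and a representation $U$ of $G$ on $X$ by invertible bounded operators, with $\pi(\alpha_s(a))=U_s\pi(a)U_s^{-1}$ for all $a\in A$, $s\in G$. It is continuous if $\pi$ is norm-bounded and $U$ is strongly continuous, and non-degenerate if the span of $\pi(A)X$ is dense in $X$. For continuous $(\pi,U)$ and $f\in C_c(G,A)$ put $\pi\rtimes U(f)x:=\int_G\pi(f(s))U_sx\,ds$ $(x\in X)$. A class $\mathcal R$ of continuous covariant representations is uniformly bounded if there are $C\ge0$ and $\nu:G\to[0,\infty)$, bounded on compact sets, such that $\|\pi\|\le C$ and $\|U_r\|\le\nu(r)$ for all $(\pi,U)\in\mathcal R$ and $r\in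 G$. For a non-empty such class let $\sigma^{\mathcal R}(f):=\sup_{(\pi,U)\in\mathcal R}\|\pi\rtimes U(f)\|$. This is an algebra seminorm on $C_c(G,A)$ with the twisted convolution $(f*g)(s)=\int_Gf(r)\alpha_r(g(r^{-1}s))\,dr$, and the crossed product $(A\rtimes_\alpha G)^{\mathcal R}$ is the completion of $C_c(G,A)/\ker\sigma^{\mathcal R}$. A continuous covariant representation $(\pi,U)$ is $\mathcal R$-continuous if $\pi\rtimes U$ is bounded with respect to $\sigma^{\mathcal R}$; then $(\pi\rtimes U)^{\mathcal R}:(A\rtimes_\alpha G)^{\mathcal R}\to B(X)$ denotes the induced bounded representation. Two pairs $(\pi_1,U_1)$, $(\pi_2,U_2)$ on $X$ commute if each of $\pi_1,U_1$ commutes with both $\pi_2$ and $U_2$. A bounded representation $T$ of a Banach algebra $B$ on $X$ is non-degenerate if the span of $T(B)X$ is dense in $X$. For pairwise commuting bounded representations $T_i$ of Banach algebras $B_i$ on $X$ $(1\le i\le n)$, $\widehat{\bigodot}_{i=1}^nT_i:\widehat{\bigotimes}_{i=1}^nB_i\to B(X)$ is the bounded representation of the projective tensor product determined by $b_1\otimes\cdots\otimes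 b_n\mapsto T_1(b_1)\cdots T_n(b_n)$. **Theorem.** For $i\in\{1,\dots,n\}$, let $(A_i,G_i,\alpha_i)$ be a Banach algebra dynamical system, where $A_i$ has a bounded approximate left identity, and let $\mathcal R_i$ be a non-empty uniformly bounded class of non-degenerate continuous covariant representations of $(A_i,G_i,\alpha_i)$. Let $X$ be a Banach space. Consider the $n$-tuples $((\pi_1,U_1),\dots,(\pi_n,U_n))$ where each $(\pi_i,U_i)$ is a non-degenerate $\mathcal R_i$-continuous covariant representation of $(A_i,G_i,\alpha_i)$ on $X$, and $(\pi_i,U_i)$ and $(\pi_j,U_j)$ commute whenever $i\ne j$. Then the map $$((\pi_1,U_1),\dots,(\pi_n,U_n))\mapsto\widehat{\bigodot}_{i=1}^n(\pi_i\rtimes U_i)^{\mathcal R_i}$$ is a bijection from the set of all such $n$-tuples onto the set of all non-degenerate bounded representations of $\widehat{\bigotimes}_{i=1}^n(A_i\rtimes_{\alpha_i}G_i)^{\mathcal R_i}$ on $X$. -/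

import Mathlib

open MeasureTheory Topology
open scoped CompactlySupported TensorProduct Pointwise

universe w

/-! ### Completions of (possibly non-unital) seminormed algebras -/

/-- The Banach algebra obtained from a seminormed algebra `E` by dividing out the kernel of the
seminorm and completing (the Hausdorff completion), with the continuously extended product. -/
def BanachCompletion (E : Type*) [NonUnitalSeminormedRing E] : Type _ :=
  UniformSpace.Completion E

namespace BanachCompletion

section Ring

variable {E : Type*} [NonUnitalSeminormedRing E]

noncomputable instance instNormedAddCommGroup : NormedAddCommGroup (BanachCompletion E) :=
  inferInstanceAs (NormedAddCommGroup (UniformSpace.Completion E))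

instance instCompleteSpace : CompleteSpace (BanachCompletion E) :=
  inferInstanceAs (CompleteSpace (UniformSpace.Completion E))

/-- The canonical map from `E` to its completion. -/
noncomputable def of (x : E) : BanachCompletion E := UniformSpace.Completion.toCompl x

theorem of_add (x y : E) : of (x + y) = of x + of y :=
  map_add (UniformSpace.Completion.toCompl : E →+ UniformSpace.Completion E) x y

theorem norm_of (x : E) : ‖of x‖ = ‖x‖ := UniformSpace.Completion.norm_coe x

theorem continuous_of : Continuous (of : E → BanachCompletion E) :=
  UniformSpace.Completion.continuous_coe E

theorem isDenseInducing_of : IsDenseInducing (of : E → BanachCompletion E) :=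
  UniformSpace.Completion.isDenseInducing_coe

theorem denseRange_of : DenseRange (of : E → BanachCompletion E) :=
  isDenseInducing_of.dense

noncomputable instance instMul : Mul (BanachCompletion E) :=
  ⟨Function.curry <|
    ((isDenseInducing_of (E := E)).prodMap (isDenseInducing_of (E := E))).extend
      (of ∘ Function.uncurry (· * ·))⟩

theorem of_mul (a b : E) : of (a * b) = of a * of b :=
  (((isDenseInducing_of (E := E)).prodMap (isDenseInducing_of (E := E))).extend_eq
      ((continuous_of (E := E)).comp (continuous_mul (M := E))) (a, b)).symm

theorem continuous_mul' : Continuous fun p : BanachCompletion E × BanachCompletion E =>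
    p.1 * p.2 := by
  let m : E →+ E →+ UniformSpace.Completion E :=
    (AddMonoidHom.mul : E →+ E →+ E).compr₂ UniformSpace.Completion.toCompl
  have : Continuous fun p : E × E => m p.1 p.2 :=
    (UniformSpace.Completion.continuous_coe E).comp continuous_mul
  have di : IsDenseInducing (UniformSpace.Completion.toCompl : E → UniformSpace.Completion E) :=
    UniformSpace.Completion.isDenseInducing_coe
  exact (di.extend_Z_bilin di this :)

theorem mul_closed {Z : Type*} [TopologicalSpace Z] {f g : Z → BanachCompletion E}
    (hf : Continuous f) (hg : Continuous g) : Continuous fun z => f z * g z :=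
  continuous_mul'.comp (hf.prodMk hg)

noncomputable instance instNonUnitalRing : NonUnitalRing (BanachCompletion E) where
  zero_mul a := by
    refine denseRange_of.induction_on (p := fun a => 0 * a = 0) a
      (isClosed_eq (mul_closed continuous_const continuous_id) continuous_const) fun x => ?_
    have h0 : (0 : BanachCompletion E) = of 0 := UniformSpace.Completion.coe_zero.symm
    rw [h0, ← of_mul, zero_mul]
  mul_zero a := by
    refine denseRange_of.induction_on (p := fun a => a * 0 = 0) a
      (isClosed_eq (mul_closed continuous_id continuous_const) continuous_const) fun x => ?_
    have h0 : (0 : BanachCompletion E) = of 0 := UniformSpace.Completion.coe_zero.symm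
    rw [h0, ← of_mul, mul_zero]
  mul_assoc a b c := by
    refine denseRange_of.induction_on₃ (p := fun a b c => a * b * c = a * (b * c))
      (isClosed_eq ?_ ?_) (fun x y z => ?_) a b c
    · exact mul_closed (mul_closed (by fun_prop) (by fun_prop)) (by fun_prop)
    · exact mul_closed (by fun_prop) (mul_closed (by fun_prop) (by fun_prop))
    · simp only [← of_mul, mul_assoc]
  left_distrib a b c := by
    refine denseRange_of.induction_on₃ (p := fun a b c => a * (b + c) = a * b + a * c)
      (isClosed_eq ?_ ?_) (fun x y z => ?_) a b c
    · exact mul_closed (by fun_prop) (by fun_prop)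
    · exact (mul_closed (by fun_prop) (by fun_prop)).add (mul_closed (by fun_prop) (by fun_prop))
    · simp only [← of_mul, ← of_add, mul_add]
  right_distrib a b c := by
    refine denseRange_of.induction_on₃ (p := fun a b c => (a + b) * c = a * c + b * c)
      (isClosed_eq ?_ ?_) (fun x y z => ?_) a b c
    · exact mul_closed (by fun_prop) (by fun_prop)
    · exact (mul_closed (by fun_prop) (by fun_prop)).add (mul_closed (by fun_prop) (by fun_prop))
    · simp only [← of_mul, ← of_add, add_mul]

noncomputable instance instNonUnitalNormedRing : NonUnitalNormedRing (BanachCompletion E) where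
  __ := instNormedAddCommGroup
  __ := instNonUnitalRing
  norm_mul_le a b := by
    refine denseRange_of.induction_on₂ (p := fun a b => ‖a * b‖ ≤ ‖a‖ * ‖b‖)
      (isClosed_le ?_ ?_) (fun x y => ?_) a b
    · exact (mul_closed (by fun_prop) (by fun_prop)).norm
    · fun_prop
    · rw [← of_mul, norm_of, norm_of, norm_of]
      exact norm_mul_le x y

end Ring

section Algebra

variable {𝕜 : Type*} [RCLike 𝕜] {E : Type*} [NonUnitalSeminormedRing E] [NormedSpace 𝕜 E]

noncomputable instance instNormedSpace : NormedSpace 𝕜 (BanachCompletion E) :=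
  inferInstanceAs (NormedSpace 𝕜 (UniformSpace.Completion E))

variable (𝕜 E) in
/-- The canonical map from `E` to its completion, as a continuous linear map. -/
noncomputable def ofL : E →L[𝕜] BanachCompletion E :=
  (UniformSpace.Completion.toComplL : E →L[𝕜] UniformSpace.Completion E)

theorem ofL_apply (x : E) : ofL 𝕜 E x = of x := rfl

theorem of_smul (c : 𝕜) (x : E) : of (c • x) = c • of x := UniformSpace.Completion.coe_smul c x

instance instIsScalarTower [IsScalarTower 𝕜 E E] :
    IsScalarTower 𝕜 (BanachCompletion E) (BanachCompletion E) where
  smul_assoc c a b := by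
    have h₁ : Continuous fun p : BanachCompletion E × BanachCompletion E => (c • p.1) * p.2 :=
      mul_closed (continuous_fst.const_smul c) continuous_snd
    have h₂ : Continuous fun p : BanachCompletion E × BanachCompletion E => c • (p.1 * p.2) :=
      (mul_closed continuous_fst continuous_snd).const_smul c
    refine denseRange_of.induction_on₂ (p := fun a b => (c • a) * b = c • (a * b))
      (isClosed_eq h₁ h₂) (fun x y => ?_) a b
    rw [← of_smul, ← of_mul, ← of_mul, ← of_smul, smul_mul_assoc]

instance instSMulCommClass [SMulCommClass 𝕜 E E] :
    SMulCommClass 𝕜 (BanachCompletion E) (BanachCompletion E) where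
  smul_comm c a b := by
    have h₁ : Continuous fun p : BanachCompletion E × BanachCompletion E => p.1 * (c • p.2) :=
      mul_closed continuous_fst (continuous_snd.const_smul c)
    have h₂ : Continuous fun p : BanachCompletion E × BanachCompletion E => c • (p.1 * p.2) :=
      (mul_closed continuous_fst continuous_snd).const_smul c
    refine denseRange_of.induction_on₂ (p := fun a b => c • (a * b) = a * (c • b))
      (isClosed_eq h₂ h₁) (fun x y => ?_) a b
    rw [← of_smul, ← of_mul, ← of_mul, ← of_smul, mul_smul_comm]

/-- The extension by continuity of a bounded linear map to the completion. -/
noncomputable def extend {F : Type*} [NormedAddCommGroup F] [NormedSpace 𝕜 F] [CompleteSpace F]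
    (T : E →L[𝕜] F) : BanachCompletion E →L[𝕜] F :=
  T.extend (ofL 𝕜 E)

theorem extend_of {F : Type*} [NormedAddCommGroup F] [NormedSpace 𝕜 F] [CompleteSpace F]
    (T : E →L[𝕜] F) (x : E) : extend T (of x) = T x :=
  T.extend_eq (e := ofL 𝕜 E) denseRange_of
    (UniformSpace.Completion.isUniformInducing_coe E) x

end Algebra

end BanachCompletion

/-! ### Projective tensor products of finitely many Banach algebras -/

section ProjectiveTensor

variable (𝕜 : Type*) [RCLike 𝕜] {n : ℕ} (B : Fin n → Type*) [∀ i, NonUnitalNormedRing (B i)]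
  [∀ i, NormedSpace 𝕜 (B i)] [∀ i, IsScalarTower 𝕜 (B i) (B i)]
  [∀ i, SMulCommClass 𝕜 (B i) (B i)]

/-- The algebraic tensor product `⨂ i, B i`, regarded as an algebra with
`(⨂ bᵢ) (⨂ cᵢ) = ⨂ bᵢ cᵢ` and equipped with the projective tensor norm. -/
def AlgTensorProduct : Type _ := ⨂[𝕜] i, B i

noncomputable instance AlgTensorProduct.instSeminormedAddCommGroup :
    SeminormedAddCommGroup (AlgTensorProduct 𝕜 B) :=
  inferInstanceAs (SeminormedAddCommGroup (⨂[𝕜] i, B i))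

noncomputable instance AlgTensorProduct.instMul : Mul (AlgTensorProduct 𝕜 B) :=
  inferInstanceAs (Mul (⨂[𝕜] i, B i))

noncomputable instance AlgTensorProduct.instNonUnitalSemiring :
    NonUnitalSemiring (AlgTensorProduct 𝕜 B) :=
  inferInstanceAs (NonUnitalSemiring (⨂[𝕜] i, B i))

variable {𝕜 B} in
theorem AlgTensorProduct.bound (f : (⨂[𝕜] i, B i) →ₗ[𝕜] ⨂[𝕜] i, B i) {C : ℝ} (hC : 0 ≤ C)
    (h : ∀ m : Π i, B i, ‖f (PiTensorProduct.tprod 𝕜 m)‖ ≤ C * ∏ i, ‖m i‖) (x : ⨂[𝕜] i, B i) :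
    ‖f x‖ ≤ C * ‖x‖ := by
  let g := MultilinearMap.mkContinuous (f.compMultilinearMap (PiTensorProduct.tprod 𝕜)) C h
  have h₁ := PiTensorProduct.norm_eval_le_projectiveSeminorm g x
  have h₂ : PiTensorProduct.lift g.toMultilinearMap = f := by
    ext m
    simp only [PiTensorProduct.lift.tprod, LinearMap.compMultilinearMap_apply]
    rfl
  rw [h₂] at h₁
  exact h₁.trans (mul_le_mul_of_nonneg_right (MultilinearMap.mkContinuous_norm_le _ hC _)
    (norm_nonneg _))

theorem AlgTensorProduct.norm_mul_le' (x y : ⨂[𝕜] i, B i) : ‖x * y‖ ≤ ‖x‖ * ‖y‖ := by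
  refine AlgTensorProduct.bound (PiTensorProduct.mul x) (norm_nonneg x) (fun m' => ?_) y
  rw [mul_comm]
  refine AlgTensorProduct.bound (PiTensorProduct.mul.flip (PiTensorProduct.tprod 𝕜 m'))
    (Finset.prod_nonneg fun i _ => norm_nonneg _) (fun m => ?_) x
  rw [LinearMap.flip_apply, PiTensorProduct.mul_tprod_tprod, ← Finset.prod_mul_distrib]
  refine (PiTensorProduct.projectiveSeminorm_tprod_le _).trans ?_
  refine Finset.prod_le_prod (fun i _ => norm_nonneg _) fun i _ => ?_
  rw [mul_comm]
  exact norm_mul_le _ _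

noncomputable instance AlgTensorProduct.instNonUnitalSeminormedRing :
    NonUnitalSeminormedRing (AlgTensorProduct 𝕜 B) where
  __ := AlgTensorProduct.instSeminormedAddCommGroup 𝕜 B
  __ := AlgTensorProduct.instNonUnitalSemiring 𝕜 B
  norm_mul_le x y := AlgTensorProduct.norm_mul_le' 𝕜 B x y

noncomputable instance AlgTensorProduct.instNormedSpace : NormedSpace 𝕜 (AlgTensorProduct 𝕜 B) :=
  inferInstanceAs (NormedSpace 𝕜 (⨂[𝕜] i, B i))

instance AlgTensorProduct.instIsScalarTower :
    IsScalarTower 𝕜 (AlgTensorProduct 𝕜 B) (AlgTensorProduct 𝕜 B) where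
  smul_assoc c x y := (PiTensorProduct.mul (R := 𝕜) (A := B)).map_smul₂ c x y

instance AlgTensorProduct.instSMulCommClass :
    SMulCommClass 𝕜 (AlgTensorProduct 𝕜 B) (AlgTensorProduct 𝕜 B) where
  smul_comm c x y := ((PiTensorProduct.mul (R := 𝕜) (A := B) x).map_smul c y).symm

/-- The projective tensor product of the Banach algebras `B i`, as a Banach algebra. -/
abbrev ProjTensorProduct : Type _ := BanachCompletion (AlgTensorProduct 𝕜 B)

variable {𝕜 B} in
/-- For bounded linear maps `T i : B i → B(X)`, the bounded linear map `T₁ ⊙ ⋯ ⊙ Tₙ` on the projective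
tensor product determined by `⨂ bᵢ ↦ T₁(b₁) T₂(b₂) ⋯ Tₙ(bₙ)`. It is used for commuting
representations `T i`. -/
noncomputable def sunProduct {X : Type*} [NormedAddCommGroup X] [NormedSpace 𝕜 X]
    [CompleteSpace X] (T : ∀ i, B i →L[𝕜] (X →L[𝕜] X)) :
    ProjTensorProduct 𝕜 B →L[𝕜] (X →L[𝕜] X) :=
  BanachCompletion.extend (PiTensorProduct.liftIsometry 𝕜 B (X →L[𝕜] X)
    ((ContinuousMultilinearMap.mkPiAlgebraFin 𝕜 n (X →L[𝕜] X)).compContinuousLinearMap T) :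
      (⨂[𝕜] i, B i) →L[𝕜] (X →L[𝕜] X))

variable {𝕜 B} in
/-- The elementary tensor `⨂ bᵢ` in the projective tensor product. -/
noncomputable def elemTensor (b : ∀ i, B i) : ProjTensorProduct 𝕜 B :=
  BanachCompletion.of (E := AlgTensorProduct 𝕜 B) (PiTensorProduct.tprod 𝕜 b)

variable {𝕜 B} in
theorem sunProduct_elemTensor {X : Type*} [NormedAddCommGroup X] [NormedSpace 𝕜 X]
    [CompleteSpace X] (T : ∀ i, B i →L[𝕜] (X →L[𝕜] X)) (b : ∀ i, B i) :
    sunProduct T (elemTensor b) = (List.ofFn fun i => T i (b i)).prod := by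
  refine (BanachCompletion.extend_of _ _).trans ?_
  exact (PiTensorProduct.liftIsometry_apply_apply _ _).trans (by simp)

end ProjectiveTensor

/-! ### Integrals of compactly supported continuous vector-valued functions -/

section Integral

variable {G : Type*} [TopologicalSpace G] [MeasurableSpace G]

/-- The integral of a vector-valued function; over `𝕜 = ℂ` the real structure used by the Bochner
integral is the underlying one. -/
noncomputable def vecIntegral (𝕜 : Type*) [RCLike 𝕜] {E : Type*} [NormedAddCommGroup E]
    [NormedSpace 𝕜 E] (μ : Measure G) (f : G → E) : E :=
  letI : NormedSpace ℝ E := NormedSpace.restrictScalars ℝ 𝕜 E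
  ∫ s, f s ∂μ

variable {𝕜 : Type*} [RCLike 𝕜] {E F : Type*} [NormedAddCommGroup E] [NormedSpace 𝕜 E]
  [NormedAddCommGroup F] [NormedSpace 𝕜 F] [BorelSpace G] {μ : Measure G}
  [IsFiniteMeasureOnCompacts μ]

theorem vecIntegral_clm [CompleteSpace E] [CompleteSpace F] (L : E →L[𝕜] F) {f : G → E}
    (hf : Continuous f) (hc : HasCompactSupport f) :
    vecIntegral 𝕜 μ (fun s => L (f s)) = L (vecIntegral 𝕜 μ f) := by
  let _ : NormedSpace ℝ E := NormedSpace.restrictScalars ℝ 𝕜 E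
  let _ : NormedSpace ℝ F := NormedSpace.restrictScalars ℝ 𝕜 F
  exact L.integral_comp_comm (hf.integrable_of_hasCompactSupport hc)

theorem vecIntegral_add {f g : G → E}
    (hf : Continuous f) (hfc : HasCompactSupport f) (hg : Continuous g)
    (hgc : HasCompactSupport g) :
    vecIntegral 𝕜 μ (fun s => f s + g s) = vecIntegral 𝕜 μ f + vecIntegral 𝕜 μ g := by
  let _ : NormedSpace ℝ E := NormedSpace.restrictScalars ℝ 𝕜 E
  exact integral_add (hf.integrable_of_hasCompactSupport hfc)
    (hg.integrable_of_hasCompactSupport hgc)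

theorem norm_vecIntegral_le (f : G → E) : ‖vecIntegral 𝕜 μ f‖ ≤ ∫ s, ‖f s‖ ∂μ := by
  let _ : NormedSpace ℝ E := NormedSpace.restrictScalars ℝ 𝕜 E
  exact norm_integral_le_integral_norm f

theorem vecIntegral_swap {f : G → G → E} (hf : Continuous f.uncurry)
    (hc : HasCompactSupport f.uncurry) :
    vecIntegral 𝕜 μ (fun s => vecIntegral 𝕜 μ (fun t => f s t)) =
      vecIntegral 𝕜 μ (fun t => vecIntegral 𝕜 μ (fun s => f s t)) := by
  let _ : NormedSpace ℝ E := NormedSpace.restrictScalars ℝ 𝕜 E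
  exact integral_integral_swap_of_hasCompactSupport hf hc

theorem continuous_vecIntegral {Z : Type*} [TopologicalSpace Z] {f : Z → G → E} {k : Set G}
    (hk : IsCompact k) (hf : Continuous f.uncurry) (h0 : ∀ z, ∀ s, s ∉ k → f z s = 0) :
    Continuous fun z => vecIntegral 𝕜 μ (f z) := by
  let _ : NormedSpace ℝ E := NormedSpace.restrictScalars ℝ 𝕜 E
  rw [← continuousOn_univ]
  exact continuousOn_integral_of_compact_support hk hf.continuousOn fun z s _ hs => h0 z s hs

theorem vecIntegral_shift [Group G] [IsTopologicalGroup G] [μ.IsMulLeftInvariant] (f : G → E)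
    (r : G) : vecIntegral 𝕜 μ (fun s => f (r⁻¹ * s)) = vecIntegral 𝕜 μ f := by
  let _ : NormedSpace ℝ E := NormedSpace.restrictScalars ℝ 𝕜 E
  exact integral_mul_left_eq_self f r⁻¹

/-- A strongly continuous family of operators on a Banach space is bounded on compact sets. -/
theorem bounded_on_compact {Z : Type*} [TopologicalSpace Z] [CompleteSpace E]
    {U : Z → E →L[𝕜] F} (hU : ∀ x, Continuous fun z => U z x) {K : Set Z} (hK : IsCompact K) :
    ∃ M, 0 ≤ M ∧ ∀ z ∈ K, ‖U z‖ ≤ M := by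
  obtain ⟨M, hM⟩ := banach_steinhaus (g := fun z : K => U z) fun x => by
    obtain ⟨C, hC⟩ := hK.exists_bound_of_continuousOn (hU x).continuousOn
    exact ⟨C, fun z => hC z z.2⟩
  exact ⟨max M 0, le_max_right _ _, fun z hz => (hM ⟨z, hz⟩).trans (le_max_left _ _)⟩

theorem continuous_strong {Z Y : Type*} [TopologicalSpace Z] [LocallyCompactSpace Z]
    [TopologicalSpace Y] [CompleteSpace E]
    {U : Z → E →L[𝕜] F} (hU : ∀ x, Continuous fun z => U z x) {u : Y → Z} {v : Y → E}
    (hu : Continuous u) (hv : Continuous v) : Continuous fun y => U (u y) (v y) := by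
  suffices h : Continuous fun p : Z × E => U p.1 p.2 from h.comp (hu.prodMk hv)
  rw [continuous_iff_continuousAt]
  rintro ⟨z₀, x₀⟩
  obtain ⟨K, hK, hz₀⟩ := exists_compact_mem_nhds z₀
  obtain ⟨M, hM0, hM⟩ := bounded_on_compact hU hK
  have h₁ : Filter.Tendsto (fun p : Z × E => U p.1 (p.2 - x₀)) (𝓝 (z₀, x₀)) (𝓝 0) := by
    refine squeeze_zero_norm' (a := fun p => M * ‖p.2 - x₀‖) ?_ ?_
    · filter_upwards [continuous_fst.continuousAt.preimage_mem_nhds (x := (z₀, x₀)) hz₀] with p hp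
      exact (U p.1).le_of_opNorm_le (hM _ hp) _
    · have : Continuous fun p : Z × E => M * ‖p.2 - x₀‖ := by fun_prop
      simpa using this.tendsto (z₀, x₀)
  have h₂ : Filter.Tendsto (fun p : Z × E => U p.1 x₀) (𝓝 (z₀, x₀)) (𝓝 (U z₀ x₀)) :=
    ((hU x₀).comp continuous_fst).tendsto (z₀, x₀)
  have := h₁.add h₂
  simpa [ContinuousAt] using this

end Integral

/-! ### Banach algebra dynamical systems and covariant representations -/

section Systems

/-- `A` has a bounded approximate left identity. -/
def HasBoundedApproxLeftId (A : Type*) [NonUnitalNormedRing A] : Prop :=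
  ∃ l : Filter A, l.NeBot ∧ (∃ M : ℝ, ∀ᶠ u in l, ‖u‖ ≤ M) ∧
    ∀ a : A, Filter.Tendsto (fun u => u * a) l (𝓝 a)

/-- A Banach algebra dynamical system `(A, G, α)`: a strongly continuous representation of `G` on
`A` by bounded algebra automorphisms. -/
structure BanachDynamicalSystem (𝕜 A G : Type*) [RCLike 𝕜] [NonUnitalNormedRing A]
    [NormedSpace 𝕜 A] [Group G] [TopologicalSpace G] where
  act : G →* (A →L[𝕜] A)
  act_mul : ∀ s a b, act s (a * b) = act s a * act s b
  continuous_act : ∀ a, Continuous fun s => act s a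

variable {𝕜 A G : Type*} [RCLike 𝕜] [NonUnitalNormedRing A] [NormedSpace 𝕜 A] [Group G]
  [TopologicalSpace G]

/-- A covariant representation `(π, U)` of `(A, G, α)` on `X`. As `U` is a homomorphism of monoids
defined on a group, it takes values in the invertible operators and `U s⁻¹ = (U s)⁻¹`. -/
structure CovariantRep (α : BanachDynamicalSystem 𝕜 A G) (X : Type*) [NormedAddCommGroup X]
    [NormedSpace 𝕜 X] where
  π : A →ₙₐ[𝕜] (X →L[𝕜] X)
  U : G →* (X →L[𝕜] X)
  covariant : ∀ s a, π (α.act s a) = U s * π a * U s⁻¹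

/-- A continuous covariant representation: `π` is norm-bounded and `U` is strongly continuous. -/
structure ContCovariantRep (α : BanachDynamicalSystem 𝕜 A G) (X : Type*) [NormedAddCommGroup X]
    [NormedSpace 𝕜 X] extends CovariantRep α X where
  bounded : ∃ C : ℝ, ∀ a, ‖π a‖ ≤ C * ‖a‖
  continuous : ∀ x, Continuous fun s => U s x

/-- `(π, U)` is non-degenerate: the span of `π(A)X` is dense in `X`. -/
def CovariantRep.IsNondegenerate {α : BanachDynamicalSystem 𝕜 A G} {X : Type*}
    [NormedAddCommGroup X] [NormedSpace 𝕜 X] (ρ : CovariantRep α X) : Prop :=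
  Dense (Submodule.span 𝕜 {y : X | ∃ a x, ρ.π a x = y} : Set X)

/-- The pairs `(π₁, U₁)` and `(π₂, U₂)` commute: each of `π₁`, `U₁` commutes with both `π₂` and
`U₂`. -/
def CovariantRep.CommutesWith {A' G' : Type*} [NonUnitalNormedRing A'] [NormedSpace 𝕜 A'] [Group G']
    [TopologicalSpace G'] {α : BanachDynamicalSystem 𝕜 A G} {α' : BanachDynamicalSystem 𝕜 A' G'}
    {X : Type*} [NormedAddCommGroup X] [NormedSpace 𝕜 X] (ρ : CovariantRep α X)
    (ρ' : CovariantRep α' X) : Prop :=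
  (∀ a a', Commute (ρ.π a) (ρ'.π a')) ∧ (∀ a s', Commute (ρ.π a) (ρ'.U s')) ∧
    (∀ s a', Commute (ρ.U s) (ρ'.π a')) ∧ (∀ s s', Commute (ρ.U s) (ρ'.U s'))

/-- A continuous covariant representation of `(A, G, α)` together with the Banach space on which it
acts. -/
structure BundledCovariantRep (α : BanachDynamicalSystem 𝕜 A G) where
  X : Type w
  [instNormedAddCommGroup : NormedAddCommGroup X]
  [instNormedSpace : NormedSpace 𝕜 X]
  [instCompleteSpace : CompleteSpace X]
  rep : ContCovariantRep α X

attribute [instance] BundledCovariantRep.instNormedAddCommGroup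
  BundledCovariantRep.instNormedSpace BundledCovariantRep.instCompleteSpace

/-- A non-empty uniformly bounded class of continuous covariant representations of `(A, G, α)`
(on arbitrary Banach spaces in a universe). -/
structure UniformlyBoundedClass (α : BanachDynamicalSystem 𝕜 A G) where
  carrier : Set (BundledCovariantRep.{w} α)
  nonempty : carrier.Nonempty
  uniformly_bounded : ∃ (C : ℝ) (ν : G → ℝ), 0 ≤ C ∧ (∀ r, 0 ≤ ν r) ∧
    (∀ K, IsCompact K → BddAbove (ν '' K)) ∧
    ∀ ρ ∈ carrier, (∀ a, ‖ρ.rep.π a‖ ≤ C * ‖a‖) ∧ ∀ r, ‖ρ.rep.U r‖ ≤ ν r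

end Systems

/-! ### Twisted convolution and integrated forms -/

section Crossed

variable {𝕜 A G : Type*} [RCLike 𝕜] [NonUnitalNormedRing A] [NormedSpace 𝕜 A]
  [IsScalarTower 𝕜 A A] [SMulCommClass 𝕜 A A] [CompleteSpace A] [Group G]
  [TopologicalSpace G] [IsTopologicalGroup G] [LocallyCompactSpace G] [T2Space G]
  [MeasurableSpace G] [BorelSpace G] {α : BanachDynamicalSystem 𝕜 A G}

namespace BanachDynamicalSystem

theorem act_act (α : BanachDynamicalSystem 𝕜 A G) (s t : G) (a : A) :
    α.act s (α.act t a) = α.act (s * t) a := by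
  rw [map_mul]; rfl

/-- If `f` and `g` vanish outside their compact supports then `(s, r) ↦ H (f r) (g (r⁻¹ s))` has
compact support. -/
theorem compactSupport_prod {E : Type*} [Zero E] {f g : G → A} (hf : HasCompactSupport f)
    (hg : HasCompactSupport g) {F : G → G → E} (h₁ : ∀ s r, f r = 0 → F s r = 0)
    (h₂ : ∀ s r, g (r⁻¹ * s) = 0 → F s r = 0) : HasCompactSupport F.uncurry := by
  refine HasCompactSupport.intro ((hf.isCompact.mul hg.isCompact).prod hf.isCompact) ?_
  rintro ⟨s, r⟩ hsr
  by_cases hr : r ∈ tsupport f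
  · refine h₂ s r (image_eq_zero_of_notMem_tsupport fun h => hsr ⟨?_, hr⟩)
    exact ⟨r, hr, r⁻¹ * s, h, by simp⟩
  · exact h₁ s r (image_eq_zero_of_notMem_tsupport hr)

theorem continuous_convIntegrand (α : BanachDynamicalSystem 𝕜 A G) (f g : C_c(G, A)) :
    Continuous (Function.uncurry fun s r : G => f r * α.act r (g (r⁻¹ * s))) := by
  have h : Continuous fun p : G × G => α.act p.2 (g (p.2⁻¹ * p.1)) :=
    continuous_strong α.continuous_act continuous_snd
      (g.continuous.comp (continuous_snd.inv.mul continuous_fst))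
  exact (f.continuous.comp continuous_snd).mul h

/-- The twisted convolution `(f * g)(s) = ∫ f(r) α_r(g(r⁻¹ s)) dr` on `C_c(G, A)`. -/
noncomputable def twistedConv (α : BanachDynamicalSystem 𝕜 A G) (μ : Measure G)
    [IsFiniteMeasureOnCompacts μ] (f g : C_c(G, A)) : C_c(G, A) where
  toFun s := vecIntegral 𝕜 μ fun r => f r * α.act r (g (r⁻¹ * s))
  continuous_toFun := continuous_vecIntegral f.hasCompactSupport.isCompact
    (α.continuous_convIntegrand f g) fun s r hr => by
      rw [image_eq_zero_of_notMem_tsupport hr, zero_mul]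
  hasCompactSupport' := by
    refine HasCompactSupport.intro
      (f.hasCompactSupport.isCompact.mul g.hasCompactSupport.isCompact) fun s hs => ?_
    have : (fun r => f r * α.act r (g (r⁻¹ * s))) = fun _ => 0 := by
      funext r
      by_cases hr : r ∈ tsupport f
      · have : r⁻¹ * s ∉ tsupport g := fun h => hs ⟨r, hr, r⁻¹ * s, h, by simp⟩
        rw [image_eq_zero_of_notMem_tsupport this, map_zero, mul_zero]
      · rw [image_eq_zero_of_notMem_tsupport hr, zero_mul]
    simp [this, vecIntegral]

variable (α : BanachDynamicalSystem 𝕜 A G) (μ : Measure G) [IsFiniteMeasureOnCompacts μ]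

theorem twistedConv_apply (f g : C_c(G, A)) (s : G) :
    α.twistedConv μ f g s = vecIntegral 𝕜 μ fun r => f r * α.act r (g (r⁻¹ * s)) := rfl

theorem continuous_convSlice (f g : C_c(G, A)) (s : G) :
    Continuous fun r : G => f r * α.act r (g (r⁻¹ * s)) :=
  (α.continuous_convIntegrand f g).comp (continuous_const.prodMk continuous_id)

theorem compactSupport_convSlice (f g : C_c(G, A)) (s : G) :
    HasCompactSupport fun r : G => f r * α.act r (g (r⁻¹ * s)) :=
  f.hasCompactSupport.mul_right

theorem twistedConv_add (f g h : C_c(G, A)) :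
    α.twistedConv μ f (g + h) = α.twistedConv μ f g + α.twistedConv μ f h := by
  ext s
  rw [CompactlySupportedContinuousMap.add_apply]
  simp only [twistedConv_apply]
  rw [← vecIntegral_add (α.continuous_convSlice f g s) (α.compactSupport_convSlice f g s)
    (α.continuous_convSlice f h s) (α.compactSupport_convSlice f h s)]
  simp [mul_add]

theorem add_twistedConv (f g h : C_c(G, A)) :
    α.twistedConv μ (f + g) h = α.twistedConv μ f h + α.twistedConv μ g h := by
  ext s
  rw [CompactlySupportedContinuousMap.add_apply]
  simp only [twistedConv_apply]
  rw [← vecIntegral_add (α.continuous_convSlice f h s) (α.compactSupport_convSlice f h s)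
    (α.continuous_convSlice g h s) (α.compactSupport_convSlice g h s)]
  simp [add_mul]

theorem smul_twistedConv (c : 𝕜) (f g : C_c(G, A)) :
    α.twistedConv μ (c • f) g = c • α.twistedConv μ f g := by
  ext s
  rw [CompactlySupportedContinuousMap.smul_apply]
  simp only [twistedConv_apply]
  have := vecIntegral_clm (μ := μ) (c • ContinuousLinearMap.id 𝕜 A) (α.continuous_convSlice f g s)
    (α.compactSupport_convSlice f g s)
  simpa [smul_mul_assoc] using this

theorem twistedConv_smul (c : 𝕜) (f g : C_c(G, A)) :
    α.twistedConv μ f (c • g) = c • α.twistedConv μ f g := by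
  ext s
  rw [CompactlySupportedContinuousMap.smul_apply]
  simp only [twistedConv_apply]
  have := vecIntegral_clm (μ := μ) (c • ContinuousLinearMap.id 𝕜 A) (α.continuous_convSlice f g s)
    (α.compactSupport_convSlice f g s)
  simpa [mul_smul_comm] using this

theorem twistedConv_assoc [μ.IsMulLeftInvariant] (f g h : C_c(G, A)) :
    α.twistedConv μ (α.twistedConv μ f g) h = α.twistedConv μ f (α.twistedConv μ g h) := by
  ext s
  have e₁ : ∀ t, α.twistedConv μ f g t * α.act t (h (t⁻¹ * s)) =
      vecIntegral 𝕜 μ fun r => f r * α.act r (g (r⁻¹ * t)) * α.act t (h (t⁻¹ * s)) := fun t =>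
    (vecIntegral_clm ((ContinuousLinearMap.mul 𝕜 A).flip (α.act t (h (t⁻¹ * s))))
      (α.continuous_convSlice f g t) (α.compactSupport_convSlice f g t)).symm
  have e₂ : ∀ r, f r * α.act r (α.twistedConv μ g h (r⁻¹ * s)) =
      vecIntegral 𝕜 μ fun t => f r * α.act r (g t * α.act t (h (t⁻¹ * (r⁻¹ * s)))) := fun r =>
    (vecIntegral_clm ((ContinuousLinearMap.mul 𝕜 A (f r)).comp (α.act r))
      (α.continuous_convSlice g h (r⁻¹ * s)) (α.compactSupport_convSlice g h (r⁻¹ * s))).symm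
  have e₃ : ∀ r, (vecIntegral 𝕜 μ fun t => f r * α.act r (g t * α.act t (h (t⁻¹ * (r⁻¹ * s))))) =
      vecIntegral 𝕜 μ fun t => f r * α.act r (g (r⁻¹ * t)) * α.act t (h (t⁻¹ * s)) := by
    intro r
    rw [← vecIntegral_shift _ r]
    congr 1
    funext t
    rw [α.act_mul, act_act, mul_assoc]
    simp [mul_assoc]
  rw [twistedConv_apply α μ _ h, twistedConv_apply α μ f]
  simp only [e₁, e₂, e₃]
  refine vecIntegral_swap
    (f := fun t r => f r * α.act r (g (r⁻¹ * t)) * α.act t (h (t⁻¹ * s))) ?_ ?_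
  · refine (α.continuous_convIntegrand f g).mul ?_
    exact continuous_strong α.continuous_act continuous_fst
      (h.continuous.comp (continuous_fst.inv.mul continuous_const))
  · refine compactSupport_prod f.hasCompactSupport g.hasCompactSupport ?_ ?_
    · intro t r h0; rw [h0, zero_mul, zero_mul]
    · intro t r h0; rw [h0, map_zero, mul_zero, zero_mul]

end BanachDynamicalSystem

namespace ContCovariantRep

variable {X : Type*} [NormedAddCommGroup X] [NormedSpace 𝕜 X] [CompleteSpace X]
  (ρ : ContCovariantRep α X)

theorem exists_bound : ∃ C : ℝ, 0 ≤ C ∧ ∀ a, ‖ρ.π a‖ ≤ C * ‖a‖ := by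
  obtain ⟨C, hC⟩ := ρ.bounded
  exact ⟨max C 0, le_max_right _ _, fun a => (hC a).trans
    (mul_le_mul_of_nonneg_right (le_max_left _ _) (norm_nonneg _))⟩

/-- `π` as a bounded linear map. -/
noncomputable def πL : A →L[𝕜] (X →L[𝕜] X) :=
  (ρ.π : A →ₗ[𝕜] (X →L[𝕜] X)).mkContinuousOfExistsBound ρ.bounded

theorem πL_apply (a : A) : ρ.πL a = ρ.π a := rfl

theorem continuous_integrand (f : C_c(G, A)) (x : X) :
    Continuous fun s => ρ.π (f s) (ρ.U s x) :=
  (ρ.πL.continuous.comp f.continuous).clm_apply (ρ.continuous x)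

theorem compactSupport_integrand (f : C_c(G, A)) (x : X) :
    HasCompactSupport fun s => ρ.π (f s) (ρ.U s x) := by
  refine HasCompactSupport.intro f.hasCompactSupport.isCompact fun s hs => ?_
  rw [image_eq_zero_of_notMem_tsupport hs, map_zero]
  rfl

variable (μ : Measure G) [IsFiniteMeasureOnCompacts μ]

theorem norm_integral_le (f : C_c(G, A)) {C M : ℝ} (hC : 0 ≤ C) (hπ : ∀ a, ‖ρ.π a‖ ≤ C * ‖a‖)
    (hU : ∀ s ∈ tsupport f, ‖ρ.U s‖ ≤ M) (x : X) :
    ‖vecIntegral 𝕜 μ fun s => ρ.π (f s) (ρ.U s x)‖ ≤ (C * M * ∫ s, ‖f s‖ ∂μ) * ‖x‖ := by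
  refine (norm_vecIntegral_le _).trans ?_
  have h₁ : ∀ s, ‖ρ.π (f s) (ρ.U s x)‖ ≤ C * M * ‖x‖ * ‖f s‖ := by
    intro s
    by_cases hs : s ∈ tsupport f
    · calc ‖ρ.π (f s) (ρ.U s x)‖ ≤ (C * ‖f s‖) * ‖ρ.U s x‖ := (ρ.π (f s)).le_of_opNorm_le (hπ _) _
        _ ≤ (C * ‖f s‖) * (M * ‖x‖) := by
          gcongr
          exact (ρ.U s).le_of_opNorm_le (hU s hs) _
        _ = _ := by ring
    · simp [image_eq_zero_of_notMem_tsupport hs]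
  calc ∫ s, ‖ρ.π (f s) (ρ.U s x)‖ ∂μ ≤ ∫ s, C * M * ‖x‖ * ‖f s‖ ∂μ := by
        refine integral_mono ?_ ?_ h₁
        · exact ((ρ.continuous_integrand f x).integrable_of_hasCompactSupport
            (ρ.compactSupport_integrand f x)).norm
        · exact ((f.continuous.integrable_of_hasCompactSupport f.hasCompactSupport).norm).const_mul _
    _ = _ := by rw [integral_const_mul]; ring

/-- The operator `π ⋊ U(f)`, given by `x ↦ ∫ π(f(s)) U_s x ds`. -/
noncomputable def integratedOp (f : C_c(G, A)) : X →L[𝕜] X :=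
  LinearMap.mkContinuousOfExistsBound
    { toFun := fun x => vecIntegral 𝕜 μ fun s => ρ.π (f s) (ρ.U s x)
      map_add' := fun x y => by
        rw [← vecIntegral_add (ρ.continuous_integrand f x) (ρ.compactSupport_integrand f x)
          (ρ.continuous_integrand f y) (ρ.compactSupport_integrand f y)]
        simp
      map_smul' := fun c x => by
        have := vecIntegral_clm (μ := μ) (c • ContinuousLinearMap.id 𝕜 X)
          (ρ.continuous_integrand f x) (ρ.compactSupport_integrand f x)
        simpa using this }
    (by
      obtain ⟨C, hC, hπ⟩ := ρ.exists_bound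
      obtain ⟨M, -, hM⟩ := bounded_on_compact ρ.continuous f.hasCompactSupport.isCompact
      exact ⟨_, ρ.norm_integral_le μ f hC hπ hM⟩)

theorem integratedOp_apply (f : C_c(G, A)) (x : X) :
    ρ.integratedOp μ f x = vecIntegral 𝕜 μ fun s => ρ.π (f s) (ρ.U s x) := rfl

/-- The integrated form `π ⋊ U : C_c(G, A) → B(X)`. -/
noncomputable def integratedForm : C_c(G, A) →ₗ[𝕜] (X →L[𝕜] X) where
  toFun := ρ.integratedOp μ
  map_add' f g := by
    ext x
    rw [add_apply]
    simp only [integratedOp_apply]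
    rw [← vecIntegral_add (ρ.continuous_integrand f x) (ρ.compactSupport_integrand f x)
      (ρ.continuous_integrand g x) (ρ.compactSupport_integrand g x)]
    simp
  map_smul' c f := by
    ext x
    have := vecIntegral_clm (μ := μ) (c • ContinuousLinearMap.id 𝕜 X)
      (ρ.continuous_integrand f x) (ρ.compactSupport_integrand f x)
    simpa [integratedOp_apply] using this

theorem integratedForm_apply (f : C_c(G, A)) (x : X) :
    ρ.integratedForm μ f x = vecIntegral 𝕜 μ fun s => ρ.π (f s) (ρ.U s x) := rfl

theorem norm_integratedForm_le (f : C_c(G, A)) {C M : ℝ} (hC : 0 ≤ C) (hM : 0 ≤ M)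
    (hπ : ∀ a, ‖ρ.π a‖ ≤ C * ‖a‖) (hU : ∀ s ∈ tsupport f, ‖ρ.U s‖ ≤ M) :
    ‖ρ.integratedForm μ f‖ ≤ C * M * ∫ s, ‖f s‖ ∂μ :=
  ContinuousLinearMap.opNorm_le_bound _
    (mul_nonneg (mul_nonneg hC hM) (integral_nonneg fun _ => norm_nonneg _))
    (ρ.norm_integral_le μ f hC hπ hU)

theorem integratedForm_mul [μ.IsMulLeftInvariant] (f g : C_c(G, A)) :
    ρ.integratedForm μ (α.twistedConv μ f g) = ρ.integratedForm μ f * ρ.integratedForm μ g := by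
  ext x
  have e₁ : ∀ s, ρ.π (α.twistedConv μ f g s) (ρ.U s x) =
      vecIntegral 𝕜 μ fun r => ρ.π (f r * α.act r (g (r⁻¹ * s))) (ρ.U s x) := fun s =>
    (vecIntegral_clm ((ContinuousLinearMap.apply 𝕜 X (ρ.U s x)).comp ρ.πL)
      (α.continuous_convSlice f g s) (α.compactSupport_convSlice f g s)).symm
  have e₂ : ∀ s r, ρ.π (f r * α.act r (g (r⁻¹ * s))) (ρ.U s x) =
      ρ.π (f r) (ρ.U r (ρ.π (g (r⁻¹ * s)) (ρ.U (r⁻¹ * s) x))) := by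
    intro s r
    rw [map_mul ρ.π, ρ.covariant, map_mul ρ.U]
    rfl
  have e₃ : ∀ r, (vecIntegral 𝕜 μ fun s =>
        ρ.π (f r) (ρ.U r (ρ.π (g (r⁻¹ * s)) (ρ.U (r⁻¹ * s) x)))) =
      ρ.π (f r) (ρ.U r (ρ.integratedForm μ g x)) := by
    intro r
    rw [vecIntegral_shift (fun s => ρ.π (f r) (ρ.U r (ρ.π (g s) (ρ.U s x)))) r]
    exact vecIntegral_clm ((ρ.π (f r)).comp (ρ.U r)) (ρ.continuous_integrand g x)
      (ρ.compactSupport_integrand g x)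
  change _ = ρ.integratedForm μ f (ρ.integratedForm μ g x)
  rw [integratedForm_apply, integratedForm_apply ρ μ f]
  simp only [e₁, ← e₃]
  rw [vecIntegral_swap (f := fun s r => ρ.π (f r * α.act r (g (r⁻¹ * s))) (ρ.U s x))]
  · simp only [e₂]
  · exact (ρ.πL.continuous.comp (α.continuous_convIntegrand f g)).clm_apply
      ((ρ.continuous x).comp continuous_fst)
  · refine BanachDynamicalSystem.compactSupport_prod f.hasCompactSupport g.hasCompactSupport ?_ ?_
    · intro t r h0; simp [h0]
    · intro t r h0; simp [h0]

end ContCovariantRep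

/-! ### The crossed product -/

section CrossedProduct

variable (μ : Measure G) [IsFiniteMeasureOnCompacts μ]

theorem UniformlyBoundedClass.bddAbove (R : UniformlyBoundedClass α) (f : C_c(G, A)) :
    BddAbove (Set.range fun ρ : R.carrier => ‖ρ.1.rep.integratedForm μ f‖) := by
  obtain ⟨C, ν, hC, hν, hK, h⟩ := R.uniformly_bounded
  obtain ⟨M, hM⟩ := hK _ f.hasCompactSupport.isCompact
  refine ⟨C * max M 0 * ∫ s, ‖f s‖ ∂μ, ?_⟩
  rintro _ ⟨ρ, rfl⟩
  refine ρ.1.rep.norm_integratedForm_le μ f hC (le_max_right _ _) (h _ ρ.2).1 fun s hs => ?_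
  exact ((h _ ρ.2).2 s).trans ((hM ⟨s, hs, rfl⟩).trans (le_max_left _ _))

/-- The seminorm `σ^R(f) = sup_{(π, U) ∈ R} ‖π ⋊ U(f)‖` on `C_c(G, A)`. -/
noncomputable def crossedSeminorm (R : UniformlyBoundedClass α) : Seminorm 𝕜 C_c(G, A) :=
  Seminorm.ofSMulLE (fun f => ⨆ ρ : R.carrier, ‖ρ.1.rep.integratedForm μ f‖)
    (by simp)
    (fun f g => by
      have : Nonempty R.carrier := R.nonempty.to_subtype
      refine ciSup_le fun ρ => ?_
      rw [map_add]
      exact (norm_add_le _ _).trans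
        (add_le_add (le_ciSup (R.bddAbove μ f) ρ) (le_ciSup (R.bddAbove μ g) ρ)))
    (fun c f => by
      have : Nonempty R.carrier := R.nonempty.to_subtype
      refine ciSup_le fun ρ => ?_
      rw [map_smul, norm_smul]
      exact mul_le_mul_of_nonneg_left (le_ciSup (R.bddAbove μ f) ρ) (norm_nonneg _))

theorem crossedSeminorm_apply (R : UniformlyBoundedClass α) (f : C_c(G, A)) :
    crossedSeminorm μ R f = ⨆ ρ : R.carrier, ‖ρ.1.rep.integratedForm μ f‖ := rfl

theorem crossedSeminorm_mul [μ.IsMulLeftInvariant] (R : UniformlyBoundedClass α)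
    (f g : C_c(G, A)) :
    crossedSeminorm μ R (α.twistedConv μ f g) ≤ crossedSeminorm μ R f * crossedSeminorm μ R g := by
  have : Nonempty R.carrier := R.nonempty.to_subtype
  refine ciSup_le fun ρ => ?_
  rw [ContCovariantRep.integratedForm_mul]
  exact (norm_mul_le _ _).trans (mul_le_mul (le_ciSup (R.bddAbove μ f) ρ)
    (le_ciSup (R.bddAbove μ g) ρ) (norm_nonneg _) (apply_nonneg _ _))

/-- The algebra `C_c(G, A)` with the twisted convolution and the seminorm `σ^R`. -/
def TwistedConvAlgebra (_μ : Measure G) (_R : UniformlyBoundedClass α) : Type _ := C_c(G, A)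

variable (R : UniformlyBoundedClass α)

noncomputable instance TwistedConvAlgebra.instAddCommGroup :
    AddCommGroup (TwistedConvAlgebra μ R) :=
  inferInstanceAs (AddCommGroup C_c(G, A))

noncomputable instance TwistedConvAlgebra.instModule : Module 𝕜 (TwistedConvAlgebra μ R) :=
  inferInstanceAs (Module 𝕜 C_c(G, A))

/-- `σ^R` on the algebra `TwistedConvAlgebra μ R`. -/
noncomputable def TwistedConvAlgebra.seminorm : Seminorm 𝕜 (TwistedConvAlgebra μ R) :=
  crossedSeminorm μ R

noncomputable instance TwistedConvAlgebra.instSeminormedAddCommGroup :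
    SeminormedAddCommGroup (TwistedConvAlgebra μ R) :=
  AddGroupSeminorm.toSeminormedAddCommGroup (TwistedConvAlgebra.seminorm μ R).toAddGroupSeminorm

noncomputable instance TwistedConvAlgebra.instNonUnitalSeminormedRing [μ.IsMulLeftInvariant] :
    NonUnitalSeminormedRing (TwistedConvAlgebra μ R) where
  __ := TwistedConvAlgebra.instSeminormedAddCommGroup μ R
  mul f g := α.twistedConv μ f g
  left_distrib f g h := α.twistedConv_add μ f g h
  right_distrib f g h := α.add_twistedConv μ f g h
  zero_mul f := by
    have := α.smul_twistedConv μ 0 0 f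
    rw [zero_smul, zero_smul] at this
    exact this
  mul_zero f := by
    have := α.twistedConv_smul μ 0 f 0
    rw [zero_smul, zero_smul] at this
    exact this
  mul_assoc f g h := α.twistedConv_assoc μ f g h
  norm_mul_le f g := crossedSeminorm_mul μ R f g

variable [μ.IsMulLeftInvariant]

noncomputable instance TwistedConvAlgebra.instNormedSpace :
    NormedSpace 𝕜 (TwistedConvAlgebra μ R) where
  __ := TwistedConvAlgebra.instModule μ R
  norm_smul_le c f := (map_smul_eq_mul (TwistedConvAlgebra.seminorm μ R) c f).le

instance TwistedConvAlgebra.instIsScalarTower :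
    IsScalarTower 𝕜 (TwistedConvAlgebra μ R) (TwistedConvAlgebra μ R) where
  smul_assoc c f g := α.smul_twistedConv μ c f g

instance TwistedConvAlgebra.instSMulCommClass :
    SMulCommClass 𝕜 (TwistedConvAlgebra μ R) (TwistedConvAlgebra μ R) where
  smul_comm c f g := (α.twistedConv_smul μ c f g).symm

/-- The crossed product `(A ⋊_α G)^R`. -/
abbrev CrossedProduct : Type _ := BanachCompletion (TwistedConvAlgebra μ R)

variable {X : Type*} [NormedAddCommGroup X] [NormedSpace 𝕜 X] [CompleteSpace X]

/-- `(π, U)` is `R`-continuous: it is continuous and `π ⋊ U` is bounded with respect to `σ^R`. -/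
def ContCovariantRep.IsRContinuous (ρ : ContCovariantRep α X) : Prop :=
  ∃ M : ℝ, ∀ f : C_c(G, A), ‖ρ.integratedForm μ f‖ ≤ M * crossedSeminorm μ R f

variable {R} in
/-- The integrated form of an `R`-continuous covariant representation, as a bounded linear map for
the seminorm `σ^R`. -/
noncomputable def ContCovariantRep.integratedFormL (ρ : ContCovariantRep α X)
    (h : ρ.IsRContinuous μ R) : TwistedConvAlgebra μ R →L[𝕜] (X →L[𝕜] X) :=
  let T : TwistedConvAlgebra μ R →ₗ[𝕜] (X →L[𝕜] X) := ρ.integratedForm μ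
  T.mkContinuousOfExistsBound h

variable {R} in
/-- The map `(π ⋊ U)^R : (A ⋊_α G)^R → B(X)` induced by the integrated form of an `R`-continuous
covariant representation. -/
noncomputable def ContCovariantRep.induced (ρ : ContCovariantRep α X)
    (h : ρ.IsRContinuous μ R) : CrossedProduct μ R →L[𝕜] (X →L[𝕜] X) :=
  BanachCompletion.extend (ρ.integratedFormL μ h)

/-- The quotient homomorphism `q^R : C_c(G, A) → (A ⋊_α G)^R`. -/
noncomputable def quotientMap (f : C_c(G, A)) : CrossedProduct μ R :=
  BanachCompletion.of (E := TwistedConvAlgebra μ R) f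

variable {R} in
theorem ContCovariantRep.induced_quotientMap (ρ : ContCovariantRep α X)
    (h : ρ.IsRContinuous μ R) (f : C_c(G, A)) :
    ρ.induced μ h (quotientMap μ R f) = ρ.integratedForm μ f :=
  BanachCompletion.extend_of (ρ.integratedFormL μ h) _

end CrossedProduct

end Crossed

/-! ### Bounded representations -/

section BoundedRep

variable {𝕜 B X : Type*} [RCLike 𝕜] [NonUnitalNormedRing B] [NormedSpace 𝕜 B]
  [NormedAddCommGroup X] [NormedSpace 𝕜 X]

/-- The bounded linear map `T : B → B(X)` is a non-degenerate representation of the Banach algebra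
`B` on `X`: it is multiplicative and the span of `T(B)X` is dense in `X`. -/
structure IsNondegenerateBoundedRep (T : B →L[𝕜] (X →L[𝕜] X)) : Prop where
  map_mul : ∀ b c, T (b * c) = T b * T c
  dense : Dense (Submodule.span 𝕜 {y : X | ∃ b x, T b x = y} : Set X)

end BoundedRep

/-!
A non-degenerate bounded representation of a Banach algebra `B` with a bounded approximate left
identity extends uniquely to the algebra of left multipliers of `B`. Two Banach algebras of this
kind carry enough left multipliers for that to classify their representations.

On the crossed product, `A` acts by `(a · f) s = a f(s)` and `G` by
`(r · f) s = α_r (f (r⁻¹ s))`; the integrated form of this covariant representation is left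
multiplication. Extending a representation `T` of the crossed product and restricting it to `A` and
`G` therefore recovers a covariant representation with integrated form `T`. On the projective tensor
product, each `B i` acts by left multiplication in the `i`-th factor, and the product of these
actions is again left multiplication, so extension and restriction recover `T` from pairwise
commuting representations of the factors. An operator that commutes with a representation also
commutes with its extension, so commutation passes between `(π, U)` and its integrated form.

An approximate left identity of the crossed product is obtained from one of `A` by spreading it
over a small neighbourhood of `1` with a normalised bump function.
-/

open Filter (Tendsto)

/-! ### Strong convergence of bounded families of operators -/

section StrongConvergence

variable {𝕜 X Y ι : Type*} [NontriviallyNormedField 𝕜] [NormedAddCommGroup X] [NormedSpace 𝕜 X]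
  [NormedAddCommGroup Y] [NormedSpace 𝕜 Y] {l : Filter ι} {S : ι → X →L[𝕜] Y} {M : ℝ}

theorem tendsto_clm_apply_of_norm_le (hM : ∀ᶠ i in l, ‖S i‖ ≤ M) {v : ι → X} {x : X} {y : Y}
    (hv : Tendsto v l (𝓝 x)) (hS : Tendsto (fun i => S i x) l (𝓝 y)) :
    Tendsto (fun i => S i (v i)) l (𝓝 y) := by
  have h₀ : Tendsto (fun i => S i (v i - x)) l (𝓝 0) := by
    refine squeeze_zero_norm' (hM.mono fun i hi => (S i).le_of_opNorm_le hi _) ?_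
    simpa using (tendsto_iff_norm_sub_tendsto_zero.1 hv).const_mul M
  simpa using h₀.add hS

theorem mapsTo_of_dense_span (T : X →L[𝕜] Y) {s : Set X}
    (hs : Dense (Submodule.span 𝕜 s : Set X)) {N : Submodule 𝕜 Y} (hN : IsClosed (N : Set Y))
    (h : ∀ x ∈ s, T x ∈ N) (x : X) : T x ∈ N :=
  Submodule.topologicalClosure_minimal (t := N.comap T.toLinearMap) _ (Submodule.span_le.2 h)
    (hN.preimage T.continuous) (hs x)

theorem tendsto_clm_of_dense_span {T : X →L[𝕜] Y} (hM : ∀ᶠ i in l, ‖S i‖ ≤ M) {s : Set X}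
    (hs : Dense (Submodule.span 𝕜 s : Set X))
    (h : ∀ x ∈ s, Tendsto (fun i => S i x) l (𝓝 (T x))) (x : X) :
    Tendsto (fun i => S i x) l (𝓝 (T x)) := by
  have hspan : ∀ x ∈ Submodule.span 𝕜 s, Tendsto (fun i => S i x) l (𝓝 (T x)) := by
    intro x hx
    induction hx using Submodule.span_induction with
    | mem x hx => exact h x hx
    | zero => simpa using tendsto_const_nhds
    | add x y _ _ hx hy => simpa using hx.add hy
    | smul c x _ hx => simpa using hx.const_smul c
  have hequi : Equicontinuous fun i : {i | ‖S i‖ ≤ M} => ⇑(S i) :=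
    Iff.mp (a := ∃ C, ∀ i : {i | ‖S i‖ ≤ M}, ‖S i‖ ≤ C)
      ((NormedSpace.equicontinuous_TFAE _).out 5 1) ⟨M, fun i => i.2⟩
  have hrange : Set.range ((↑) : {i | ‖S i‖ ≤ M} → ι) ∈ l := by rwa [Subtype.range_coe]
  have hclosed := hequi.isClosed_setOfPred_tendsto (l := l.comap (↑)) T.continuous
  refine (Filter.tendsto_comap'_iff hrange).1 (hclosed.closure_subset_iff.2 ?_ (hs x))
  exact fun y hy => (hspan y hy).comp Filter.tendsto_comap

theorem exists_clm_tendsto_of_dense_span [CompleteSpace Y] [l.NeBot]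
    (hM : ∀ᶠ i in l, ‖S i‖ ≤ M) {s : Set X} (hs : Dense (Submodule.span 𝕜 s : Set X))
    (h : ∀ x ∈ s, ∃ y, Tendsto (fun i => S i x) l (𝓝 y)) :
    ∃ L : X →L[𝕜] Y, ‖L‖ ≤ M ∧ ∀ x, Tendsto (fun i => S i x) l (𝓝 (L x)) := by
  have hM₀ : 0 ≤ M := hM.exists.elim fun i hi => (norm_nonneg _).trans hi
  have hdiff : ∀ x, Tendsto (fun p : ι × ι => (S p.1 - S p.2) x) (l ×ˢ l)
      (𝓝 ((0 : X →L[𝕜] Y) x)) := by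
    refine tendsto_clm_of_dense_span (M := M + M) ?_ hs fun x hx => ?_
    · filter_upwards [hM.prod_mk hM] with p hp
      exact (norm_sub_le _ _).trans (add_le_add hp.1 hp.2)
    · obtain ⟨y, hy⟩ := h x hx
      simpa using (hy.comp Filter.tendsto_fst).sub (hy.comp Filter.tendsto_snd)
  have hlim : ∀ x, ∃ y, Tendsto (fun i => S i x) l (𝓝 y) := fun x =>
    cauchy_map_iff_exists_tendsto.1 <| cauchy_map_iff'.2 <| by
      rw [uniformity_eq_comap_nhds_zero_swapped, Filter.tendsto_comap_iff]
      exact hdiff x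
  choose L hL using hlim
  let L₀ : X →ₗ[𝕜] Y :=
    { toFun := L
      map_add' := fun x y => tendsto_nhds_unique (hL _) (by simpa using (hL x).add (hL y))
      map_smul' := fun c x => tendsto_nhds_unique (hL _) (by simpa using (hL x).const_smul c) }
  have hbound : ∀ x, ‖L₀ x‖ ≤ M * ‖x‖ := fun x =>
    le_of_tendsto (hL x).norm (hM.mono fun i hi => (S i).le_of_opNorm_le hi x)
  exact ⟨L₀.mkContinuous M hbound, L₀.mkContinuous_norm_le hM₀ hbound, hL⟩

theorem continuous_clm_of_tendsto_one {G : Type*} [Group G] [TopologicalSpace G]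
    [IsTopologicalGroup G] {U : G →* (X →L[𝕜] X)} (hM : ∀ᶠ r in 𝓝 1, ‖U r‖ ≤ M) {s : Set X}
    (hs : Dense (Submodule.span 𝕜 s : Set X))
    (h : ∀ x ∈ s, Tendsto (fun r => U r x) (𝓝 1) (𝓝 x)) (x : X) : Continuous fun r => U r x := by
  have hone := tendsto_clm_of_dense_span (T := ContinuousLinearMap.id 𝕜 X) hM hs h x
  refine continuous_iff_continuousAt.2 fun r₀ => ?_
  have hshift : Tendsto (fun r => r₀⁻¹ * r) (𝓝 r₀) (𝓝 1) :=
    (continuous_const_mul r₀⁻¹).tendsto' _ _ (inv_mul_cancel r₀)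
  have hU : ∀ r, U r x = U r₀ (U (r₀⁻¹ * r) x) := fun r => by
    rw [← mul_apply_eq_comp, ← map_mul, mul_inv_cancel_left]
  exact (((U r₀).continuous.tendsto x).comp (hone.comp hshift)).congr fun r => (hU r).symm

end StrongConvergence

/-! ### Extension of representations to left multipliers -/

/-- The algebra of left multipliers of `B`: the bounded operators on `B` that commute with all right
multiplications. -/
def leftMultiplierAlgebra (𝕜 B : Type*) [RCLike 𝕜] [NonUnitalNormedRing B] [NormedSpace 𝕜 B]
    [IsScalarTower 𝕜 B B] : Subalgebra 𝕜 (B →L[𝕜] B) where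
  carrier := {L | ∀ b c, L (b * c) = L b * c}
  mul_mem' {L L'} hL hL' b c := by rw [mul_apply_eq_comp, hL', hL, mul_apply_eq_comp]
  add_mem' {L L'} hL hL' b c := by simp only [add_apply, hL b c, hL' b c, add_mul]
  algebraMap_mem' k b c := (smul_mul_assoc k b c).symm

namespace IsNondegenerateBoundedRep

section

variable {𝕜 B X : Type*} [RCLike 𝕜] [NonUnitalNormedRing B] [NormedSpace 𝕜 B]
  [NormedAddCommGroup X] [NormedSpace 𝕜 X] {T : B →L[𝕜] (X →L[𝕜] X)}

theorem ext (hT : IsNondegenerateBoundedRep T) {S S' : X →L[𝕜] X}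
    (h : ∀ b, S * T b = S' * T b) : S = S' :=
  ContinuousLinearMap.ext_on hT.dense fun _ ⟨b, x, hbx⟩ => hbx ▸ DFunLike.congr_fun (h b) x

theorem commute_of_mul_eq (hT : IsNondegenerateBoundedRep T) {V S : X →L[𝕜] X} {L : B → B}
    (hV : ∀ b, Commute V (T b)) (hS : ∀ b, S * T b = T (L b)) : Commute V S :=
  hT.ext fun b => by rw [mul_assoc, hS, (hV _).eq, ← hS, mul_assoc, ← (hV b).eq, mul_assoc]

theorem dense_of_tendsto (hT : IsNondegenerateBoundedRep T) {C : Type*} {S : C → X →L[𝕜] X}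
    {L : C → B → B} (hS : ∀ c b, S c * T b = T (L c b)) {l : Filter C} [l.NeBot]
    (hl : ∀ b, Tendsto (fun c => L c b) l (𝓝 b)) :
    Dense (Submodule.span 𝕜 {y : X | ∃ c x, S c x = y} : Set X) := by
  refine mapsTo_of_dense_span (.id 𝕜 X) hT.dense (Submodule.isClosed_topologicalClosure _) ?_
  rintro _ ⟨b, x, rfl⟩
  have hlim : Tendsto (fun c => S c (T b x)) l (𝓝 (T b x)) := by
    simp only [← mul_apply_eq_comp, hS]
    exact ((T.continuous.clm_apply continuous_const).tendsto b).comp (hl b)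
  exact mem_closure_of_tendsto hlim (.of_forall fun c => Submodule.subset_span ⟨c, _, rfl⟩)

end

variable {𝕜 B X : Type*} [RCLike 𝕜] [NonUnitalNormedRing B] [NormedSpace 𝕜 B]
  [IsScalarTower 𝕜 B B] [NormedAddCommGroup X] [NormedSpace 𝕜 X] [CompleteSpace X]
  {T : B →L[𝕜] (X →L[𝕜] X)}

theorem exists_extension (hT : IsNondegenerateBoundedRep T) (hB : HasBoundedApproxLeftId B) :
    ∃ K : ℝ, ∀ L ∈ leftMultiplierAlgebra 𝕜 B,
      ∃ S : X →L[𝕜] X, (∀ b, S * T b = T (L b)) ∧ ‖S‖ ≤ K * ‖L‖ := by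
  obtain ⟨l, hl, ⟨M, hM⟩, hu⟩ := hB
  refine ⟨‖T‖ * M, fun L hL => ?_⟩
  have hlim : ∀ b x, Tendsto (fun u => T (L u) (T b x)) l (𝓝 (T (L b) x)) := fun b x => by
    have hmul : ∀ u, T (L u) (T b x) = T (L (u * b)) x := fun u => by
      rw [hL, hT.map_mul, mul_apply_eq_comp]
    simp only [hmul]
    exact (((T.continuous.comp L.continuous).clm_apply continuous_const).tendsto b).comp (hu b)
  have hbound : ∀ᶠ u in l, ‖T (L u)‖ ≤ ‖T‖ * M * ‖L‖ := by
    filter_upwards [hM] with u hu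
    calc ‖T (L u)‖ ≤ ‖T‖ * (‖L‖ * M) :=
          T.le_of_opNorm_le_of_le le_rfl (L.le_of_opNorm_le_of_le le_rfl hu)
      _ = ‖T‖ * M * ‖L‖ := by ring
  obtain ⟨S, hSL, hS⟩ := exists_clm_tendsto_of_dense_span hbound hT.dense
    fun _ ⟨b, x, hbx⟩ => ⟨T (L b) x, hbx ▸ hlim b x⟩
  exact ⟨S, fun b => ContinuousLinearMap.ext fun x => tendsto_nhds_unique (hS _) (hlim b x), hSL⟩

/-- The extension of a non-degenerate bounded representation of a Banach algebra with a bounded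
approximate left identity to the left multipliers, characterized by `extension_mul`. -/
noncomputable def extension (hT : IsNondegenerateBoundedRep T) (hB : HasBoundedApproxLeftId B) :
    leftMultiplierAlgebra 𝕜 B →A[𝕜] (X →L[𝕜] X) :=
  have h := (hT.exists_extension hB).choose_spec
  have hS := fun L : leftMultiplierAlgebra 𝕜 B => (h L L.2).choose_spec.1
  let E : leftMultiplierAlgebra 𝕜 B →ₗ[𝕜] (X →L[𝕜] X) :=
    { toFun := fun L => (h L L.2).choose
      map_add' := fun L L' => hT.ext fun b => by rw [hS, add_mul, hS, hS, ← map_add]; rfl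
      map_smul' := fun k L => hT.ext fun b => by
        rw [hS, RingHom.id_apply, smul_mul_assoc, hS, ← map_smul]; rfl }
  { AlgHom.ofLinearMap E (hT.ext fun b => (hS 1 b).trans (one_mul _).symm) fun L L' =>
      hT.ext fun b => (hS (L * L') b).trans <| by
        rw [mul_assoc]; exact ((congrArg (E L * ·) (hS L' b)).trans (hS L _)).symm with
    cont := (E.mkContinuousOfExistsBound ⟨_, fun L => (h L L.2).choose_spec.2⟩).continuous }

theorem extension_mul (hT : IsNondegenerateBoundedRep T) (hB : HasBoundedApproxLeftId B)
    (L : leftMultiplierAlgebra 𝕜 B) (b : B) :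
    hT.extension hB L * T b = T ((L : B →L[𝕜] B) b) :=
  ((hT.exists_extension hB).choose_spec L L.2).choose_spec.1 b

end IsNondegenerateBoundedRep

/-! ### Operators on completions -/

namespace BanachCompletion

variable {𝕜 E F : Type*} [RCLike 𝕜] [NonUnitalSeminormedRing E] [NormedSpace 𝕜 E]
  [NormedAddCommGroup F] [NormedSpace 𝕜 F]

theorem clm_ext {S T : BanachCompletion E →L[𝕜] F} (h : ∀ x, S (of x) = T (of x)) : S = T :=
  DFunLike.coe_injective (denseRange_of.equalizer S.continuous T.continuous (funext h))

theorem norm_clm_apply_le (S : BanachCompletion E →L[𝕜] F) {M : ℝ}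
    (h : ∀ x, ‖S (of x)‖ ≤ M * ‖x‖) (b : BanachCompletion E) : ‖S b‖ ≤ M * ‖b‖ :=
  denseRange_of.induction_on (p := fun b => ‖S b‖ ≤ M * ‖b‖) b
    (isClosed_le (by fun_prop) (by fun_prop)) fun x => (h x).trans_eq (by rw [norm_of])

variable (𝕜 E) in
/-- The extension of bounded operators on `E` to its completion, as a bounded linear map. -/
noncomputable def mapL :
    (E →L[𝕜] E) →L[𝕜] (BanachCompletion E →L[𝕜] BanachCompletion E) :=
  LinearMap.mkContinuous
    { toFun := fun T => extend ((ofL 𝕜 E).comp T)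
      map_add' := fun S T => clm_ext fun x => by simp [extend_of]
      map_smul' := fun c T => clm_ext fun x => by simp [extend_of] }
    1 fun T => by
      refine ContinuousLinearMap.opNorm_le_bound _ (by positivity) (norm_clm_apply_le _ fun x => ?_)
      rw [LinearMap.coe_mk, AddHom.coe_mk, extend_of, ContinuousLinearMap.comp_apply, ofL_apply,
        norm_of, one_mul]
      exact T.le_opNorm x

theorem mapL_of (T : E →L[𝕜] E) (x : E) : mapL 𝕜 E T (of x) = of (T x) :=
  extend_of _ x

end BanachCompletion

/-! ### Products along a list -/

theorem list_prod_map_mul_of_commute {M ι : Type*} [Monoid M] {f g : ι → M} {l : List ι}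
    (hl : l.Nodup) (h : ∀ i j, i ≠ j → Commute (g i) (f j)) :
    (l.map fun i => f i * g i).prod = (l.map f).prod * (l.map g).prod := by
  induction l with
  | nil => simp
  | cons i l ih =>
    rw [List.nodup_cons] at hl
    have hcomm : Commute (g i) (l.map f).prod := Commute.list_prod_right _ _ fun x hx => by
      obtain ⟨j, hj, rfl⟩ := List.mem_map.1 hx
      exact h i j (ne_of_mem_of_not_mem hj hl.1).symm
    simp only [List.map_cons, List.prod_cons, ih hl.2, mul_assoc]
    rw [← mul_assoc (g i), hcomm.eq, mul_assoc]

theorem dense_span_list_prod {𝕜 ι X : Type*} [NontriviallyNormedField 𝕜] [NormedAddCommGroup X]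
    [NormedSpace 𝕜 X] {B : ι → Type*} [∀ i, Nonempty (B i)] {T : ∀ i, B i → X →L[𝕜] X}
    (hT : ∀ i, Dense (Submodule.span 𝕜 {y : X | ∃ b x, T i b x = y} : Set X))
    {l : List ι} (hl : l.Nodup) :
    Dense (Submodule.span 𝕜 {y : X | ∃ (b : ∀ i, B i) (x : X),
      (l.map fun i => T i (b i)).prod x = y} : Set X) := by
  classical
  induction l with
  | nil => simp
  | cons i l ih =>
    rw [List.nodup_cons] at hl
    refine mapsTo_of_dense_span (.id 𝕜 X) (hT i) (Submodule.isClosed_topologicalClosure _) ?_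
    rintro _ ⟨c, x, rfl⟩
    refine mapsTo_of_dense_span (T i c) (ih hl.2) (Submodule.isClosed_topologicalClosure _) ?_ x
    rintro _ ⟨b, z, rfl⟩
    refine subset_closure (Submodule.subset_span ⟨Function.update b i c, z, ?_⟩)
    have htail : ∀ j ∈ l, T j (Function.update b i c j) = T j (b j) := fun j hj => by
      rw [Function.update_of_ne (ne_of_mem_of_not_mem hj hl.1)]
    rw [List.map_cons, List.prod_cons, Function.update_self, List.map_congr_left htail]
    rfl

/-! ### Representations of projective tensor products -/

section ProjTensorProduct

variable {𝕜 : Type*} [RCLike 𝕜] {n : ℕ} {B : Fin n → Type*} [∀ i, NonUnitalNormedRing (B i)]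
  [∀ i, NormedSpace 𝕜 (B i)] [∀ i, IsScalarTower 𝕜 (B i) (B i)]
  [∀ i, SMulCommClass 𝕜 (B i) (B i)]

theorem elemTensor_mul (b c : ∀ i, B i) :
    elemTensor (𝕜 := 𝕜) (b * c) = elemTensor b * elemTensor c := by
  refine Eq.trans (congrArg BanachCompletion.of ?_) (BanachCompletion.of_mul _ _)
  exact (PiTensorProduct.mul_tprod_tprod b c).symm

theorem continuous_elemTensor : Continuous (elemTensor (𝕜 := 𝕜) (B := B)) :=
  BanachCompletion.continuous_of.comp (PiTensorProduct.tprodL 𝕜 (E := B)).cont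

theorem norm_elemTensor_le (b : ∀ i, B i) : ‖elemTensor (𝕜 := 𝕜) b‖ ≤ ∏ i, ‖b i‖ :=
  (BanachCompletion.norm_of _).le.trans (PiTensorProduct.projectiveSeminorm_tprod_le b)

theorem dense_span_elemTensor :
    Dense (Submodule.span 𝕜 (Set.range (elemTensor (𝕜 := 𝕜) (B := B))) :
      Set (ProjTensorProduct 𝕜 B)) := by
  refine BanachCompletion.denseRange_of.mono ?_
  rintro _ ⟨t, rfl⟩
  let ofₗ : (⨂[𝕜] i, B i) →ₗ[𝕜] ProjTensorProduct 𝕜 B :=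
    (BanachCompletion.ofL 𝕜 (AlgTensorProduct 𝕜 B)).toLinearMap
  have ht : (t : ⨂[𝕜] i, B i) ∈ Submodule.span 𝕜 (Set.range (PiTensorProduct.tprod 𝕜)) := by
    rw [PiTensorProduct.span_tprod_eq_top]; trivial
  have himage := Submodule.mem_map_of_mem (f := ofₗ) ht
  rwa [Submodule.map_span, ← Set.range_comp] at himage

namespace ProjTensorProduct

variable {F : Type*} [NormedAddCommGroup F] [NormedSpace 𝕜 F]

theorem ext {S T : ProjTensorProduct 𝕜 B →L[𝕜] F}
    (h : ∀ b, S (elemTensor b) = T (elemTensor b)) : S = T :=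
  ContinuousLinearMap.ext_on dense_span_elemTensor (Set.forall_mem_range.2 h)

theorem ext₂ {S T : ProjTensorProduct 𝕜 B →L[𝕜] ProjTensorProduct 𝕜 B →L[𝕜] F}
    (h : ∀ b c, S (elemTensor b) (elemTensor c) = T (elemTensor b) (elemTensor c)) : S = T :=
  ext fun b => ext (h b)

theorem mem_leftMultiplierAlgebra {L : ProjTensorProduct 𝕜 B →L[𝕜] ProjTensorProduct 𝕜 B}
    (h : ∀ b c, L (elemTensor b * elemTensor c) = L (elemTensor b) * elemTensor c) :
    L ∈ leftMultiplierAlgebra 𝕜 (ProjTensorProduct 𝕜 B) := fun b c =>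
  have heq : (ContinuousLinearMap.compL 𝕜 _ _ _ L).comp (ContinuousLinearMap.mul 𝕜 _) =
      (ContinuousLinearMap.mul 𝕜 _).comp L := ext₂ h
  DFunLike.congr_fun (DFunLike.congr_fun heq b) c

end ProjTensorProduct

/-- The operator on the projective tensor product that applies a given operator to the `i`-th
factor. -/
noncomputable def factorOp (i : Fin n) : (B i →L[𝕜] B i) →L[𝕜]
    (ProjTensorProduct 𝕜 B →L[𝕜] ProjTensorProduct 𝕜 B) :=
  (BanachCompletion.mapL 𝕜 (AlgTensorProduct 𝕜 B)).comp
    ((PiTensorProduct.mapLMultilinear 𝕜 B B).toContinuousLinearMap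
      (fun _ => ContinuousLinearMap.id 𝕜 _) i)

theorem factorOp_elemTensor (i : Fin n) (L : B i →L[𝕜] B i) (b : ∀ i, B i) :
    factorOp i L (elemTensor b) = elemTensor (Function.update b i (L (b i))) := by
  refine (BanachCompletion.mapL_of _ _).trans (congrArg BanachCompletion.of ?_)
  refine (PiTensorProduct.mapL_apply _ _).trans ((PiTensorProduct.map_tprod _ _).trans ?_)
  congr 1 with j
  rcases eq_or_ne j i with rfl | h <;> simp [*]

/-- The left multipliers of the projective tensor product given by left multiplication in the `i`-th
factor. -/
noncomputable def factorMul (i : Fin n) :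
    B i →L[𝕜] leftMultiplierAlgebra 𝕜 (ProjTensorProduct 𝕜 B) :=
  ((factorOp i).comp (ContinuousLinearMap.mul 𝕜 (B i))).codRestrict
    (Subalgebra.toSubmodule (leftMultiplierAlgebra 𝕜 (ProjTensorProduct 𝕜 B))) fun c =>
    ProjTensorProduct.mem_leftMultiplierAlgebra fun b d => by
      rw [ContinuousLinearMap.comp_apply, ← elemTensor_mul, factorOp_elemTensor,
        factorOp_elemTensor, ← elemTensor_mul]
      congr 1 with j
      rcases eq_or_ne j i with rfl | h <;> simp [mul_assoc, *]

theorem factorMul_elemTensor (i : Fin n) (c : B i) (b : ∀ i, B i) :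
    (factorMul (𝕜 := 𝕜) i c : ProjTensorProduct 𝕜 B →L[𝕜] ProjTensorProduct 𝕜 B) (elemTensor b) =
      elemTensor (Function.update b i (c * b i)) :=
  factorOp_elemTensor i _ b

theorem factorMul_mul (i : Fin n) (c d : B i) :
    factorMul (𝕜 := 𝕜) i (c * d) = factorMul i c * factorMul i d :=
  Subtype.ext <| ProjTensorProduct.ext fun b => by
    simp only [MulMemClass.coe_mul, mul_apply_eq_comp, factorMul_elemTensor, Function.update_self,
      Function.update_idem, mul_assoc]

theorem commute_factorMul {i j : Fin n} (h : i ≠ j) (c : B i) (d : B j) :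
    Commute (factorMul (𝕜 := 𝕜) i c) (factorMul j d) :=
  Subtype.ext <| ProjTensorProduct.ext fun b => by
    simp only [MulMemClass.coe_mul, mul_apply_eq_comp, factorMul_elemTensor,
      Function.update_of_ne h, Function.update_of_ne h.symm, Function.update_comm h]

theorem list_prod_factorMul_elemTensor (b c : ∀ i, B i) {l : List (Fin n)} (hl : l.Nodup) :
    ((l.map fun i => factorMul (𝕜 := 𝕜) i (b i)).prod :
      ProjTensorProduct 𝕜 B →L[𝕜] ProjTensorProduct 𝕜 B) (elemTensor c) =
      elemTensor fun j => if j ∈ l then b j * c j else c j := by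
  induction l with
  | nil => simp
  | cons i l ih =>
    rw [List.nodup_cons] at hl
    rw [List.map_cons, List.prod_cons, MulMemClass.coe_mul, mul_apply_eq_comp, ih hl.2,
      factorMul_elemTensor]
    congr 1 with j
    rcases eq_or_ne j i with rfl | h <;> simp [*]

theorem list_prod_factorMul (b : ∀ i, B i) :
    ((List.ofFn fun i => factorMul (𝕜 := 𝕜) i (b i)).prod :
      ProjTensorProduct 𝕜 B →L[𝕜] ProjTensorProduct 𝕜 B) =
      ContinuousLinearMap.mul 𝕜 _ (elemTensor b) :=
  ProjTensorProduct.ext fun c => by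
    rw [List.ofFn_eq_map, list_prod_factorMul_elemTensor b c (List.nodup_finRange n),
      ContinuousLinearMap.mul_apply', ← elemTensor_mul]
    simp only [List.mem_finRange, if_true]
    rfl

theorem tendsto_factorMul (i : Fin n) {l : Filter (B i)} {M : ℝ} (hM : ∀ᶠ u in l, ‖u‖ ≤ M)
    (hl : ∀ b, Tendsto (fun u => u * b) l (𝓝 b)) (t : ProjTensorProduct 𝕜 B) :
    Tendsto (fun u => (factorMul (𝕜 := 𝕜) i u : ProjTensorProduct 𝕜 B →L[𝕜] _) t) l (𝓝 t) := by
  refine tendsto_clm_of_dense_span (T := ContinuousLinearMap.id 𝕜 _)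
    (M := ‖factorMul (𝕜 := 𝕜) (B := B) i‖ * M) ?_ dense_span_elemTensor ?_ t
  · filter_upwards [hM] with u hu
    exact (factorMul (𝕜 := 𝕜) (B := B) i).le_of_opNorm_le_of_le le_rfl hu
  · rintro _ ⟨b, rfl⟩
    simp only [factorMul_elemTensor]
    have hcont : Continuous fun v => elemTensor (𝕜 := 𝕜) (Function.update b i v) :=
      continuous_elemTensor.comp (continuous_const.update i continuous_id)
    simpa [Function.comp_def] using (hcont.tendsto (b i)).comp (hl (b i))

theorem ProjTensorProduct.hasBoundedApproxLeftId (hB : ∀ i, HasBoundedApproxLeftId (B i)) :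
    HasBoundedApproxLeftId (ProjTensorProduct 𝕜 B) := by
  choose l hl hM hu using hB
  choose M hM using hM
  have hbound : ∀ᶠ u in Filter.pi l, ‖elemTensor (𝕜 := 𝕜) u‖ ≤ ∏ i, M i := by
    filter_upwards [Filter.eventually_all.2 fun i =>
      (Filter.tendsto_eval_pi l i).eventually (hM i)] with u hu
    exact (norm_elemTensor_le u).trans
      (Finset.prod_le_prod (fun i _ => norm_nonneg _) fun i _ => hu i)
  refine ⟨(Filter.pi l).map (elemTensor (𝕜 := 𝕜)), inferInstance, ⟨∏ i, M i, hbound⟩, fun t => ?_⟩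
  refine Filter.tendsto_map'_iff.2 (tendsto_clm_of_dense_span
    (S := fun u => ContinuousLinearMap.mul 𝕜 _ (elemTensor u)) (T := ContinuousLinearMap.id 𝕜 _)
    (hbound.mono fun u hu => (ContinuousLinearMap.opNorm_mul_apply_le _ _ _).trans hu)
    dense_span_elemTensor (Set.forall_mem_range.2 fun b => ?_) t)
  simp only [ContinuousLinearMap.mul_apply', ← elemTensor_mul]
  exact (continuous_elemTensor.tendsto b).comp
    (tendsto_pi_nhds.2 fun i => (hu i (b i)).comp (Filter.tendsto_eval_pi l i))

variable {X : Type*} [NormedAddCommGroup X] [NormedSpace 𝕜 X] [CompleteSpace X]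
  {T : ∀ i, B i →L[𝕜] (X →L[𝕜] X)}

theorem sunProduct_mul (hmul : ∀ i b c, T i (b * c) = T i b * T i c)
    (hT : ∀ i j, i ≠ j → ∀ b c, Commute (T i b) (T j c)) (s t : ProjTensorProduct 𝕜 B) :
    sunProduct T (s * t) = sunProduct T s * sunProduct T t := by
  have heq : (ContinuousLinearMap.compL 𝕜 _ _ _ (sunProduct T)).comp (ContinuousLinearMap.mul 𝕜 _) =
      (ContinuousLinearMap.mul 𝕜 _).bilinearComp (sunProduct T) (sunProduct T) :=
    ProjTensorProduct.ext₂ fun b c => by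
      change sunProduct T (elemTensor b * elemTensor c) =
        sunProduct T (elemTensor b) * sunProduct T (elemTensor c)
      simp only [← elemTensor_mul, sunProduct_elemTensor, List.ofFn_eq_map, Pi.mul_apply, hmul]
      exact list_prod_map_mul_of_commute (List.nodup_finRange n) fun i j h => hT i j h _ _
  exact DFunLike.congr_fun (DFunLike.congr_fun heq s) t

theorem mul_sunProduct (hmul : ∀ i b c, T i (b * c) = T i b * T i c)
    (hT : ∀ i j, i ≠ j → ∀ b c, Commute (T i b) (T j c)) (i : Fin n) (c : B i)
    (t : ProjTensorProduct 𝕜 B) :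
    T i c * sunProduct T t =
      sunProduct T ((factorMul (𝕜 := 𝕜) i c : ProjTensorProduct 𝕜 B →L[𝕜] _) t) := by
  have heq : (ContinuousLinearMap.mul 𝕜 _ (T i c)).comp (sunProduct T) =
      (sunProduct T).comp (factorMul (𝕜 := 𝕜) i c : ProjTensorProduct 𝕜 B →L[𝕜] _) :=
    ProjTensorProduct.ext fun b => by
      have hsingle : ((List.finRange n).map (Pi.mulSingle i (T i c))).prod = T i c := by
        rw [List.prod_map_eq_pow_single i _ fun j h _ => Pi.mulSingle_eq_of_ne h _,
          List.count_eq_one_of_mem (List.nodup_finRange n) (List.mem_finRange i), pow_one,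
          Pi.mulSingle_eq_same]
      rw [ContinuousLinearMap.comp_apply, ContinuousLinearMap.comp_apply, factorMul_elemTensor,
        sunProduct_elemTensor, sunProduct_elemTensor, ContinuousLinearMap.mul_apply',
        List.ofFn_eq_map, List.ofFn_eq_map]
      conv_lhs => rw [← hsingle]
      rw [← list_prod_map_mul_of_commute (List.nodup_finRange n)]
      · congr 2 with j : 1
        rcases eq_or_ne j i with rfl | h <;> simp [*]
      · intro j k hjk
        rcases eq_or_ne k i with rfl | h
        · rw [Pi.mulSingle_eq_same]
          exact hT j k hjk _ _
        · rw [Pi.mulSingle_eq_of_ne h]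
          exact Commute.one_right _
  exact DFunLike.congr_fun heq t

theorem IsNondegenerateBoundedRep.sunProduct (hT : ∀ i, IsNondegenerateBoundedRep (T i))
    (hcomm : ∀ i j, i ≠ j → ∀ b c, Commute (T i b) (T j c)) :
    IsNondegenerateBoundedRep (sunProduct T) where
  map_mul := sunProduct_mul (fun i => (hT i).map_mul) hcomm
  dense := by
    refine (dense_span_list_prod (fun i => (hT i).dense) (List.nodup_finRange n)).mono
      (Submodule.span_mono ?_)
    rintro _ ⟨b, x, rfl⟩
    exact ⟨elemTensor b, x, by rw [sunProduct_elemTensor, List.ofFn_eq_map]⟩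

theorem sunProduct_injOn : Set.InjOn (fun T : ∀ i, B i →L[𝕜] (X →L[𝕜] X) => sunProduct T)
    {T | (∀ i, IsNondegenerateBoundedRep (T i)) ∧
      ∀ i j, i ≠ j → ∀ b c, Commute (T i b) (T j c)} := by
  rintro T ⟨hT, hTc⟩ S ⟨hS, hSc⟩ (h : sunProduct T = sunProduct S)
  ext1 i
  ext1 c
  refine (IsNondegenerateBoundedRep.sunProduct hT hTc).ext fun t => ?_
  rw [mul_sunProduct (fun i => (hT i).map_mul) hTc, h,
    mul_sunProduct (fun i => (hS i).map_mul) hSc]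

theorem exists_sunProduct_eq (hB : ∀ i, HasBoundedApproxLeftId (B i))
    {T : ProjTensorProduct 𝕜 B →L[𝕜] (X →L[𝕜] X)} (hT : IsNondegenerateBoundedRep T) :
    ∃ S : ∀ i, B i →L[𝕜] (X →L[𝕜] X), ((∀ i, IsNondegenerateBoundedRep (S i)) ∧
      ∀ i j, i ≠ j → ∀ b c, Commute (S i b) (S j c)) ∧ sunProduct S = T := by
  let E := hT.extension (ProjTensorProduct.hasBoundedApproxLeftId hB)
  have hE : ∀ L t, E L * T t = T ((L : ProjTensorProduct 𝕜 B →L[𝕜] _) t) := hT.extension_mul _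
  refine ⟨fun i => E.toContinuousLinearMap.comp (factorMul i),
    ⟨fun i => ⟨fun b c => ?_, ?_⟩, fun i j h b c => ?_⟩,
    ProjTensorProduct.ext fun b => hT.ext fun t => ?_⟩
  · exact (congrArg E (factorMul_mul i b c)).trans (map_mul E _ _)
  · obtain ⟨l, hl, ⟨M, hM⟩, hu⟩ := hB i
    exact hT.dense_of_tendsto (fun c => hE (factorMul i c)) (tendsto_factorMul i hM hu)
  · exact (commute_factorMul h b c).map E
  · have hprod : (List.ofFn fun i => E (factorMul i (b i))).prod =
        E (List.ofFn fun i => factorMul i (b i)).prod := by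
      rw [map_list_prod, List.map_ofFn]; rfl
    rw [sunProduct_elemTensor, ← hT.map_mul]
    refine (congrArg (· * T t) hprod).trans ((hE _ _).trans ?_)
    rw [list_prod_factorMul, ContinuousLinearMap.mul_apply']

theorem bijOn_sunProduct (hB : ∀ i, HasBoundedApproxLeftId (B i)) :
    Set.BijOn (fun T : ∀ i, B i →L[𝕜] (X →L[𝕜] X) => sunProduct T)
      {T | (∀ i, IsNondegenerateBoundedRep (T i)) ∧
        ∀ i j, i ≠ j → ∀ b c, Commute (T i b) (T j c)}
      {T | IsNondegenerateBoundedRep T} :=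
  ⟨fun _ hT => .sunProduct hT.1 hT.2, sunProduct_injOn, fun _ hT => exists_sunProduct_eq hB hT⟩

end ProjTensorProduct

/-! ### Approximate units of bump functions -/

section Bumps

variable {G : Type*} [TopologicalSpace G] [MeasurableSpace G] (μ : Measure G)

/-- The non-negative compactly supported continuous functions with integral one that vanish
outside `V`. -/
def bumpFunctions (V : Set G) : Set C_c(G, ℝ) :=
  {z | (∀ s, 0 ≤ z s) ∧ (∀ s, s ∉ V → z s = 0) ∧ ∫ s, z s ∂μ = 1}

theorem monotone_bumpFunctions : Monotone (bumpFunctions μ) :=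
  fun _ _ h _ hz => ⟨hz.1, fun s hs => hz.2.1 s fun hs' => hs (h hs'), hz.2.2⟩

variable [Group G]

/-- The filter of bump functions whose supports shrink to the unit element of `G`. -/
def bumpFilter : Filter C_c(G, ℝ) := (𝓝 1).lift' (bumpFunctions μ)

variable [BorelSpace G] [IsFiniteMeasureOnCompacts μ]

theorem tendsto_integral_bump {ι E : Type*} [NormedAddCommGroup E] [NormedSpace ℝ E]
    [CompleteSpace E] {l : Filter ι} {h : ι → G → E} {x : E} (hcont : ∀ i, Continuous (h i))
    (hlim : Tendsto (Function.uncurry h) (l ×ˢ 𝓝 1) (𝓝 x)) :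
    Tendsto (fun p : C_c(G, ℝ) × ι => ∫ s, p.1 s • h p.2 s ∂μ) (bumpFilter μ ×ˢ l) (𝓝 x) := by
  refine Metric.nhds_basis_closedBall.tendsto_right_iff.2 fun ε hε => ?_
  obtain ⟨P, hP, Q, hQ, hPQ⟩ := Filter.eventually_prod_iff.1
    (hlim.eventually (Metric.closedBall_mem_nhds x hε))
  filter_upwards [Filter.Eventually.prod_mk (Filter.mem_lift' hQ : ∀ᶠ z in bumpFilter μ, _) hP]
  rintro ⟨z, i⟩ ⟨⟨hz₀, hzQ, hz₁⟩, hi⟩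
  have hzi : Integrable z μ := z.continuous.integrable_of_hasCompactSupport z.hasCompactSupport
  have hzh : Integrable (fun s => z s • h i s) μ :=
    (z.continuous.smul (hcont i)).integrable_of_hasCompactSupport z.hasCompactSupport.smul_right
  have hsub : (∫ s, z s • h i s ∂μ) - x = ∫ s, z s • (h i s - x) ∂μ := by
    simp only [smul_sub]
    rw [integral_sub hzh (hzi.smul_const x), integral_smul_const, hz₁, one_smul]
  have hle : ∀ s, ‖z s • (h i s - x)‖ ≤ z s * ε := fun s => by
    by_cases hs : Q s
    · rw [norm_smul, Real.norm_of_nonneg (hz₀ s), ← dist_eq_norm]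
      exact mul_le_mul_of_nonneg_left (hPQ hi hs) (hz₀ s)
    · simp [hzQ s hs]
  rw [Metric.mem_closedBall, dist_eq_norm, hsub]
  calc ‖∫ s, z s • (h i s - x) ∂μ‖ ≤ ∫ s, z s * ε ∂μ :=
        norm_integral_le_of_norm_le (hzi.mul_const _) (.of_forall hle)
    _ = ε := by rw [integral_mul_const, hz₁, one_mul]

variable [IsTopologicalGroup G] [LocallyCompactSpace G]

theorem bumpFunctions_nonempty [μ.IsOpenPosMeasure] {V : Set G} (hV : V ∈ 𝓝 1) :
    (bumpFunctions μ V).Nonempty := by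
  obtain ⟨f, hf₁, hfc, hfV, hf₀⟩ := exists_continuousMap_one_of_isCompact_subset_isOpen
    (isCompact_singleton (x := (1 : G))) isOpen_interior
    (Set.singleton_subset_iff.2 (mem_interior_iff_mem_nhds.2 hV))
  have hpos : 0 < ∫ s, f s ∂μ :=
    f.continuous.integral_pos_of_hasCompactSupport_nonneg_nonzero hfc (fun s => (hf₀ s).1)
      (x := 1) (by rw [hf₁ rfl]; exact one_ne_zero)
  let z : C_c(G, ℝ) := ⟨f, hfc⟩
  have hz : ∀ s, ((∫ s, f s ∂μ)⁻¹ • z) s = (∫ s, f s ∂μ)⁻¹ * f s := fun _ => rfl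
  refine ⟨(∫ s, f s ∂μ)⁻¹ • z, fun s => ?_, fun s hs => ?_, ?_⟩
  · rw [hz]
    exact mul_nonneg (inv_nonneg.2 hpos.le) (hf₀ s).1
  · rw [hz, image_eq_zero_of_notMem_tsupport fun h => hs (interior_subset (hfV h)), mul_zero]
  · simp only [hz]
    rw [integral_const_mul, inv_mul_cancel₀ hpos.ne']

instance bumpFilter_neBot [μ.IsOpenPosMeasure] : (bumpFilter μ).NeBot :=
  (Filter.lift'_neBot_iff (monotone_bumpFunctions μ)).2 fun _ hV => bumpFunctions_nonempty μ hV

end Bumps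

/-! ### Operations on compactly supported functions -/

section CompactlySupportedOperations

variable {𝕜 A G : Type*} [RCLike 𝕜] [NonUnitalNormedRing A] [NormedSpace 𝕜 A]
  [TopologicalSpace G]

/-- The function `s ↦ z(s) u`. -/
noncomputable def bumpTensor (𝕜 : Type*) [RCLike 𝕜] [NormedSpace 𝕜 A] (z : C_c(G, ℝ)) (u : A) :
    C_c(G, A) where
  toFun s := (z s : 𝕜) • u
  continuous_toFun := (RCLike.continuous_ofReal.comp z.continuous).smul continuous_const
  hasCompactSupport' := z.hasCompactSupport.mono <| Function.support_subset_iff'.2 fun s hs => by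
    simp [Function.notMem_support.1 hs]

theorem bumpTensor_apply (z : C_c(G, ℝ)) (u : A) (s : G) :
    bumpTensor 𝕜 z u s = (z s : 𝕜) • u := rfl

/-- Pointwise left multiplication `(a f)(s) = a f(s)` of functions by elements of `A`. -/
noncomputable def pointwiseMul (𝕜 A G : Type*) [RCLike 𝕜] [NonUnitalNormedRing A] [NormedSpace 𝕜 A]
    [IsScalarTower 𝕜 A A] [SMulCommClass 𝕜 A A] [TopologicalSpace G] :
    A →ₗ[𝕜] C_c(G, A) →ₗ[𝕜] C_c(G, A) :=
  LinearMap.mk₂ 𝕜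
    (fun a f =>
      { toFun := fun s => a * f s
        continuous_toFun := continuous_const.mul f.continuous
        hasCompactSupport' := f.hasCompactSupport.mul_left })
    (fun a b f => by ext s; exact add_mul a b (f s))
    (fun c a f => by ext s; exact smul_mul_assoc c a (f s))
    (fun a f g => by ext s; exact mul_add a (f s) (g s))
    (fun c a f => by ext s; exact mul_smul_comm c a (f s))

theorem pointwiseMul_apply [IsScalarTower 𝕜 A A] [SMulCommClass 𝕜 A A] (a : A) (f : C_c(G, A))
    (s : G) : pointwiseMul 𝕜 A G a f s = a * f s := rfl

theorem pointwiseMul_mul [IsScalarTower 𝕜 A A] [SMulCommClass 𝕜 A A] (a b : A) (f : C_c(G, A)) :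
    pointwiseMul 𝕜 A G (a * b) f = pointwiseMul 𝕜 A G a (pointwiseMul 𝕜 A G b f) := by
  ext s
  exact mul_assoc a b (f s)

namespace BanachDynamicalSystem

variable [Group G] (α : BanachDynamicalSystem 𝕜 A G)

theorem act_eq_zero_of_notMem (f : C_c(G, A)) {K : Set G} {r t : G} (hr : r ∈ K)
    (ht : t ∉ K * tsupport f) : α.act r (f (r⁻¹ * t)) = 0 := by
  rw [image_eq_zero_of_notMem_tsupport fun h => ht ⟨r, hr, r⁻¹ * t, h, mul_inv_cancel_left r t⟩,
    map_zero]

variable [IsTopologicalGroup G]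

/-- The translation action `(r f)(t) = α_r(f(r⁻¹ t))` of `G` on `C_c(G, A)`. -/
noncomputable def translate : G →* Module.End 𝕜 C_c(G, A) where
  toFun r :=
    { toFun := fun f =>
        { toFun := fun t => α.act r (f (r⁻¹ * t))
          continuous_toFun := (α.act r).continuous.comp (f.continuous.comp (continuous_const_mul _))
          hasCompactSupport' :=
            (f.hasCompactSupport.comp_homeomorph (Homeomorph.mulLeft r⁻¹)).comp_left
              (map_zero (α.act r)) }
      map_add' := fun f g => by ext t; exact map_add (α.act r) _ _
      map_smul' := fun c f => by ext t; exact map_smul (α.act r) c _ }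
  map_one' := by ext f t; simp
  map_mul' r s := by
    ext f t
    change α.act (r * s) (f ((r * s)⁻¹ * t)) = α.act r (α.act s (f (s⁻¹ * (r⁻¹ * t))))
    rw [map_mul, mul_inv_rev, mul_assoc, mul_apply_eq_comp]

theorem translate_apply (r : G) (f : C_c(G, A)) (t : G) :
    α.translate r f t = α.act r (f (r⁻¹ * t)) := rfl

theorem translate_pointwiseMul [IsScalarTower 𝕜 A A] [SMulCommClass 𝕜 A A] (r : G) (a : A)
    (f : C_c(G, A)) :
    α.translate r (pointwiseMul 𝕜 A G a f) = pointwiseMul 𝕜 A G (α.act r a) (α.translate r f) := by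
  ext t
  exact α.act_mul r a _

theorem tendsto_translate_apply [CompleteSpace A] [LocallyCompactSpace G] (f : C_c(G, A)) (t : G) :
    Tendsto (fun p : G × G => α.translate p.1 f p.2) (𝓝 1 ×ˢ 𝓝 t) (𝓝 (f t)) := by
  have hcont : Continuous fun p : G × G => α.act p.1 (f (p.1⁻¹ * p.2)) :=
    continuous_strong α.continuous_act continuous_fst
      (f.continuous.comp (continuous_fst.inv.mul continuous_snd))
  simpa [translate_apply, nhds_prod_eq] using hcont.tendsto (1, t)

end BanachDynamicalSystem

end CompactlySupportedOperations

/-! ### Integrated forms -/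

namespace ContCovariantRep

variable {𝕜 A G X : Type*} [RCLike 𝕜] [NonUnitalNormedRing A] [NormedSpace 𝕜 A] [Group G]
  [TopologicalSpace G] {α : BanachDynamicalSystem 𝕜 A G} [NormedAddCommGroup X] [NormedSpace 𝕜 X]

theorem ext_of_eq {ρ ρ' : ContCovariantRep α X} (hπ : ρ.π = ρ'.π) (hU : ρ.U = ρ'.U) : ρ = ρ' := by
  obtain ⟨⟨π, U, _⟩, _, _⟩ := ρ
  obtain ⟨⟨π', U', _⟩, _, _⟩ := ρ'
  obtain rfl : π = π' := hπ
  obtain rfl : U = U' := hU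
  rfl

variable (ρ : ContCovariantRep α X)

theorem tendsto_π (hρ : ρ.IsNondegenerate) {l : Filter A} {M : ℝ} (hM : ∀ᶠ u in l, ‖u‖ ≤ M)
    (hl : ∀ a, Tendsto (fun u => u * a) l (𝓝 a)) (x : X) :
    Tendsto (fun u => ρ.π u x) l (𝓝 x) := by
  refine tendsto_clm_of_dense_span (S := ρ.πL) (T := .id 𝕜 X) (M := ‖ρ.πL‖ * M) ?_ hρ ?_ x
  · filter_upwards [hM] with u hu
    exact ρ.πL.le_of_opNorm_le_of_le le_rfl hu
  · rintro _ ⟨a, y, rfl⟩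
    have hmul : ∀ u, ρ.πL u (ρ.π a y) = ρ.πL (u * a) y := fun u =>
      DFunLike.congr_fun (map_mul ρ.π u a).symm y
    simp only [hmul]
    exact ((ρ.πL.continuous.clm_apply continuous_const).tendsto a).comp (hl a)

variable [IsScalarTower 𝕜 A A] [SMulCommClass 𝕜 A A] [CompleteSpace A] [IsTopologicalGroup G]
  [LocallyCompactSpace G] [T2Space G] [MeasurableSpace G] [BorelSpace G] [CompleteSpace X]
  (μ : Measure G) [IsFiniteMeasureOnCompacts μ]

theorem clm_integratedForm_apply {Y : Type*} [NormedAddCommGroup Y] [NormedSpace 𝕜 Y]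
    [CompleteSpace Y] (S : X →L[𝕜] Y) (f : C_c(G, A)) (x : X) :
    S (ρ.integratedForm μ f x) = vecIntegral 𝕜 μ fun s => S (ρ.π (f s) (ρ.U s x)) :=
  (vecIntegral_clm S (ρ.continuous_integrand f x) (ρ.compactSupport_integrand f x)).symm

theorem integratedForm_pointwiseMul (a : A) (f : C_c(G, A)) :
    ρ.integratedForm μ (pointwiseMul 𝕜 A G a f) = ρ.π a * ρ.integratedForm μ f := by
  ext x
  rw [mul_apply_eq_comp, clm_integratedForm_apply, integratedForm_apply]
  simp only [pointwiseMul_apply, map_mul, mul_apply_eq_comp]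

theorem integratedForm_translate [μ.IsMulLeftInvariant] (r : G) (f : C_c(G, A)) :
    ρ.integratedForm μ (α.translate r f) = ρ.U r * ρ.integratedForm μ f := by
  have hint : ∀ t x, ρ.π (α.translate r f t) (ρ.U t x) =
      ρ.U r (ρ.π (f (r⁻¹ * t)) (ρ.U (r⁻¹ * t) x)) := fun t x => by
    rw [BanachDynamicalSystem.translate_apply, ρ.covariant, map_mul ρ.U]
    rfl
  ext x
  rw [mul_apply_eq_comp, clm_integratedForm_apply, integratedForm_apply]
  simp only [hint]
  exact vecIntegral_shift (fun s => ρ.U r (ρ.π (f s) (ρ.U s x))) r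

theorem map_integratedForm_apply {Y : Type*} [NormedAddCommGroup Y] [NormedSpace 𝕜 Y]
    [CompleteSpace Y] {κ : ContCovariantRep α Y} {T : Y →L[𝕜] (X →L[𝕜] X)}
    (hπ : ∀ a y, T (κ.π a y) = ρ.π a * T y) (hU : ∀ s y, T (κ.U s y) = ρ.U s * T y)
    (f : C_c(G, A)) (y : Y) : T (κ.integratedForm μ f y) = ρ.integratedForm μ f * T y := by
  ext x
  refine (κ.clm_integratedForm_apply μ ((ContinuousLinearMap.apply 𝕜 X x).comp T) f y).trans ?_
  simp only [ContinuousLinearMap.comp_apply, ContinuousLinearMap.apply_apply, hπ, hU,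
    mul_apply_eq_comp]
  exact (ρ.integratedForm_apply μ f (T y x)).symm

theorem commute_integratedForm {S : X →L[𝕜] X} (hπ : ∀ a, Commute S (ρ.π a))
    (hU : ∀ s, Commute S (ρ.U s)) (f : C_c(G, A)) : Commute S (ρ.integratedForm μ f) := by
  have hint : ∀ s x, S (ρ.π (f s) (ρ.U s x)) = ρ.π (f s) (ρ.U s (S x)) := fun s =>
    DFunLike.congr_fun ((hπ (f s)).mul_right (hU s)).eq
  ext x
  rw [mul_apply_eq_comp, mul_apply_eq_comp, clm_integratedForm_apply, integratedForm_apply]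
  simp only [hint]

theorem tendsto_integratedForm_bumpTensor {l : Filter A} {M : ℝ} (hM : ∀ᶠ u in l, ‖u‖ ≤ M)
    {x : X} (hl : Tendsto (fun u => ρ.π u x) l (𝓝 x)) :
    Tendsto (fun p : C_c(G, ℝ) × A => ρ.integratedForm μ (bumpTensor 𝕜 p.1 p.2) x)
      (bumpFilter μ ×ˢ l) (𝓝 x) := by
  let _ : NormedSpace ℝ X := .restrictScalars ℝ 𝕜 X
  have hint : ∀ (z : C_c(G, ℝ)) u, ρ.integratedForm μ (bumpTensor 𝕜 z u) x =
      ∫ s, z s • ρ.π u (ρ.U s x) ∂μ := fun z u => by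
    rw [integratedForm_apply]
    simp only [bumpTensor_apply, map_smul, smul_apply]
    rfl
  simp only [hint]
  refine tendsto_integral_bump μ (fun u => (ρ.π u).continuous.comp (ρ.continuous x)) ?_
  have hM' : ∀ᶠ p : A × G in l ×ˢ 𝓝 1, ‖ρ.πL p.1‖ ≤ ‖ρ.πL‖ * M :=
    Filter.Eventually.prod_inl (hM.mono fun u hu => ρ.πL.le_of_opNorm_le_of_le le_rfl hu) _
  have hU : Tendsto (fun s => ρ.U s x) (𝓝 1) (𝓝 x) := by
    simpa only [map_one, one_apply_eq_self] using (ρ.continuous x).tendsto 1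
  exact tendsto_clm_apply_of_norm_le hM' (hU.comp Filter.tendsto_snd) (hl.comp Filter.tendsto_fst)

end ContCovariantRep

/-! ### The crossed product -/

section CrossedProductModule

variable {𝕜 A G : Type*} [RCLike 𝕜] [NonUnitalNormedRing A] [NormedSpace 𝕜 A]
  [IsScalarTower 𝕜 A A] [SMulCommClass 𝕜 A A] [CompleteSpace A] [Group G]
  [TopologicalSpace G] [IsTopologicalGroup G] [LocallyCompactSpace G] [T2Space G]
  [MeasurableSpace G] [BorelSpace G] {α : BanachDynamicalSystem 𝕜 A G}
  (μ : Measure G) [IsFiniteMeasureOnCompacts μ] (R : UniformlyBoundedClass.{w} α)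

section Seminorm

variable {μ R}

theorem UniformlyBoundedClass.norm_integratedForm_le_crossedSeminorm {ρ : BundledCovariantRep α}
    (hρ : ρ ∈ R.carrier) (f : C_c(G, A)) :
    ‖ρ.rep.integratedForm μ f‖ ≤ crossedSeminorm μ R f :=
  le_ciSup (R.bddAbove μ f) ⟨ρ, hρ⟩

theorem UniformlyBoundedClass.isRContinuous {ρ : BundledCovariantRep α} (hρ : ρ ∈ R.carrier) :
    ρ.rep.IsRContinuous μ R :=
  ⟨1, fun f => (R.norm_integratedForm_le_crossedSeminorm hρ f).trans_eq (one_mul _).symm⟩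

theorem crossedSeminorm_le {f : C_c(G, A)} {M : ℝ}
    (h : ∀ ρ ∈ R.carrier, ‖ρ.rep.integratedForm μ f‖ ≤ M) : crossedSeminorm μ R f ≤ M :=
  have : Nonempty R.carrier := R.nonempty.to_subtype
  ciSup_le fun ρ => h ρ.1 ρ.2

theorem crossedSeminorm_le_mul {f g : C_c(G, A)} {M : ℝ}
    (h : ∀ ρ ∈ R.carrier, ∃ S : ρ.X →L[𝕜] ρ.X, ‖S‖ ≤ M ∧
      ρ.rep.integratedForm μ g = S * ρ.rep.integratedForm μ f) :
    crossedSeminorm μ R g ≤ M * crossedSeminorm μ R f := by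
  refine crossedSeminorm_le fun ρ hρ => ?_
  obtain ⟨S, hS, hSg⟩ := h ρ hρ
  rw [hSg]
  exact norm_mul_le_of_le hS (R.norm_integratedForm_le_crossedSeminorm hρ f)

end Seminorm

theorem exists_crossedSeminorm_pointwiseMul_le :
    ∃ C : ℝ, ∀ a f, crossedSeminorm μ R (pointwiseMul 𝕜 A G a f) ≤
      C * ‖a‖ * crossedSeminorm μ R f := by
  obtain ⟨C, ν, -, -, -, h⟩ := R.uniformly_bounded
  exact ⟨C, fun a f => crossedSeminorm_le_mul fun ρ hρ =>
    ⟨ρ.rep.π a, (h ρ hρ).1 a, ρ.rep.integratedForm_pointwiseMul μ a f⟩⟩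

theorem exists_crossedSeminorm_translate_le [μ.IsMulLeftInvariant] {K : Set G} (hK : IsCompact K) :
    ∃ M : ℝ, 0 ≤ M ∧ ∀ r ∈ K, ∀ f, crossedSeminorm μ R (α.translate r f) ≤
      M * crossedSeminorm μ R f := by
  obtain ⟨C, ν, -, -, hν, h⟩ := R.uniformly_bounded
  obtain ⟨M, hM⟩ := hν K hK
  exact ⟨max M 0, le_max_right _ _, fun r hr f => crossedSeminorm_le_mul fun ρ hρ =>
    ⟨ρ.rep.U r, ((h ρ hρ).2 r).trans ((hM ⟨r, hr, rfl⟩).trans (le_max_left _ _)),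
      ρ.rep.integratedForm_translate μ r f⟩⟩

theorem exists_crossedSeminorm_le_integral {K : Set G} (hK : IsCompact K) :
    ∃ D : ℝ, 0 ≤ D ∧ ∀ f : C_c(G, A), (∀ s, s ∉ K → f s = 0) →
      crossedSeminorm μ R f ≤ D * ∫ s, ‖f s‖ ∂μ := by
  obtain ⟨C, ν, hC, -, hν, h⟩ := R.uniformly_bounded
  obtain ⟨M, hM⟩ := hν K hK
  refine ⟨C * max M 0, by positivity, fun f hf => crossedSeminorm_le fun ρ hρ =>
    ρ.rep.norm_integratedForm_le μ f hC (le_max_right _ _) (h ρ hρ).1 fun s hs => ?_⟩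
  have hsK : s ∈ K := closure_minimal (Function.support_subset_iff'.2 hf) hK.isClosed hs
  exact ((h ρ hρ).2 s).trans ((hM ⟨s, hsK, rfl⟩).trans (le_max_left _ _))

variable [μ.IsMulLeftInvariant]

theorem norm_quotientMap (f : C_c(G, A)) : ‖quotientMap μ R f‖ = crossedSeminorm μ R f :=
  BanachCompletion.norm_of (E := TwistedConvAlgebra μ R) f

theorem denseRange_quotientMap : DenseRange (quotientMap μ R) :=
  BanachCompletion.denseRange_of (E := TwistedConvAlgebra μ R)

theorem dense_span_quotientMap :
    Dense (Submodule.span 𝕜 (Set.range (quotientMap μ R)) : Set (CrossedProduct μ R)) :=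
  (denseRange_quotientMap μ R).mono Submodule.subset_span

theorem tendsto_quotientMap {ι : Type*} {l : Filter ι} {F : ι → C_c(G, A)} {f : C_c(G, A)}
    {K : Set G} (hK : IsCompact K) (hF : ∀ᶠ i in l, ∀ s, s ∉ K → F i s = 0)
    (hf : ∀ s, s ∉ K → f s = 0)
    (hlim : ∀ s ∈ K, Tendsto (fun p : ι × G => F p.1 p.2) (l ×ˢ 𝓝 s) (𝓝 (f s))) :
    Tendsto (fun i => quotientMap μ R (F i)) l (𝓝 (quotientMap μ R f)) := by
  obtain ⟨D, hD, hσ⟩ := exists_crossedSeminorm_le_integral μ R hK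
  refine Metric.tendsto_nhds.2 fun ε hε => ?_
  obtain ⟨δ, hδ, hδε⟩ := exists_pos_mul_lt hε (D * μ.real K)
  have hunif : ∀ᶠ i in l, ∀ s ∈ K, ‖F i s - f s‖ < δ := by
    have hnear : ∀ s ∈ K, ∀ᶠ p : ι × G in l ×ˢ 𝓝 s, ‖F p.1 p.2 - f p.2‖ < δ := fun s hs =>
      ((hlim s hs).sub
        ((f.continuous.tendsto s).comp Filter.tendsto_snd)).norm.eventually_lt_const
          (by simpa using hδ)
    filter_upwards [Filter.Eventually.curry (hK.mem_prod_nhdsSet_of_forall hnear)] with i hi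
    exact hi.self_of_nhdsSet
  filter_upwards [hunif, hF] with i hi hFi
  have hsupp : ∀ s, s ∉ K → (F i - f) s = 0 := fun s hs => by
    rw [CompactlySupportedContinuousMap.sub_apply, hFi s hs, hf s hs, sub_zero]
  calc dist (quotientMap μ R (F i)) (quotientMap μ R f) = crossedSeminorm μ R (F i - f) := by
        rw [dist_eq_norm, ← norm_quotientMap]
        exact congrArg norm (map_sub (BanachCompletion.ofL 𝕜 (TwistedConvAlgebra μ R)) _ _).symm
    _ ≤ D * ∫ s, ‖(F i - f) s‖ ∂μ := hσ _ hsupp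
    _ ≤ D * (δ * μ.real K) := by
        gcongr
        rw [← setIntegral_eq_integral_of_forall_compl_eq_zero fun s hs => by
          rw [hsupp s hs, norm_zero]]
        refine (Real.le_norm_self _).trans (norm_setIntegral_le_of_norm_le_const hK.measure_lt_top
          fun s hs => ?_)
        rw [norm_norm]
        exact (hi s hs).le
    _ < ε := by rwa [mul_comm δ, ← mul_assoc]

theorem tendsto_quotientMap_pointwiseMul {l : Filter A} {M : ℝ} (hM : ∀ᶠ u in l, ‖u‖ ≤ M)
    (hl : ∀ a, Tendsto (fun u => u * a) l (𝓝 a)) (f : C_c(G, A)) :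
    Tendsto (fun u => quotientMap μ R (pointwiseMul 𝕜 A G u f)) l (𝓝 (quotientMap μ R f)) := by
  have hvanish : ∀ s, s ∉ tsupport f → f s = 0 := fun s => image_eq_zero_of_notMem_tsupport
  refine tendsto_quotientMap μ R f.hasCompactSupport.isCompact
    (.of_forall fun u s hs => by rw [pointwiseMul_apply, hvanish s hs, mul_zero]) hvanish
    fun s _ => ?_
  have hM' : ∀ᶠ p : A × G in l ×ˢ 𝓝 s, ‖ContinuousLinearMap.mul 𝕜 A p.1‖ ≤ M :=
    Filter.Eventually.prod_inl
      (hM.mono fun u hu => (ContinuousLinearMap.opNorm_mul_apply_le 𝕜 A u).trans hu) _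
  exact tendsto_clm_apply_of_norm_le hM' ((f.continuous.tendsto s).comp Filter.tendsto_snd)
    ((hl (f s)).comp Filter.tendsto_fst)

theorem tendsto_quotientMap_translate (f : C_c(G, A)) :
    Tendsto (fun r => quotientMap μ R (α.translate r f)) (𝓝 1) (𝓝 (quotientMap μ R f)) := by
  obtain ⟨N, hN, hN₁⟩ := exists_compact_mem_nhds (1 : G)
  refine tendsto_quotientMap μ R (hN.mul f.hasCompactSupport.isCompact)
    (Filter.eventually_of_mem hN₁ fun r hr t => α.act_eq_zero_of_notMem f hr) (fun t ht => ?_)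
    fun t _ => α.tendsto_translate_apply f t
  simpa using α.act_eq_zero_of_notMem f (mem_of_mem_nhds hN₁) ht

section Separation

variable {μ R} {F : Type*} [NormedAddCommGroup F] [NormedSpace 𝕜 F]

theorem CrossedProduct.clm_ext {S T : CrossedProduct μ R →L[𝕜] F}
    (h : ∀ f, S (quotientMap μ R f) = T (quotientMap μ R f)) : S = T :=
  BanachCompletion.clm_ext h

theorem ContCovariantRep.induced_mul {X : Type*} [NormedAddCommGroup X] [NormedSpace 𝕜 X]
    [CompleteSpace X] (ρ : ContCovariantRep α X) (h : ρ.IsRContinuous μ R)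
    (b c : CrossedProduct μ R) : ρ.induced μ h (b * c) = ρ.induced μ h b * ρ.induced μ h c := by
  refine (denseRange_quotientMap μ R).induction_on₂ (p := fun b c =>
    ρ.induced μ h (b * c) = ρ.induced μ h b * ρ.induced μ h c)
    (isClosed_eq (by fun_prop) (by fun_prop)) (fun f g => ?_) b c
  have hmul : quotientMap μ R f * quotientMap μ R g = quotientMap μ R (α.twistedConv μ f g) :=
    (BanachCompletion.of_mul (E := TwistedConvAlgebra μ R) f g).symm
  simp only [hmul, ContCovariantRep.induced_quotientMap, ContCovariantRep.integratedForm_mul]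

theorem UniformlyBoundedClass.norm_induced_apply_le {ρ : BundledCovariantRep α}
    (hρ : ρ ∈ R.carrier) (b : CrossedProduct μ R) :
    ‖ρ.rep.induced μ (R.isRContinuous hρ) b‖ ≤ ‖b‖ := by
  refine (BanachCompletion.norm_clm_apply_le _ (fun f => ?_) b).trans_eq (one_mul _)
  exact (congrArg norm (ρ.rep.induced_quotientMap μ _ f)).trans_le <|
    (R.norm_integratedForm_le_crossedSeminorm hρ f).trans_eq (one_mul _).symm

theorem CrossedProduct.norm_le {b : CrossedProduct μ R} {M : ℝ}
    (h : ∀ ρ, ∀ hρ : ρ ∈ R.carrier, ‖ρ.rep.induced μ (R.isRContinuous hρ) b‖ ≤ M) : ‖b‖ ≤ M := by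
  suffices hdist : ∀ c : CrossedProduct μ R, ‖c‖ ≤ M + ‖c - b‖ by simpa using hdist b
  refine fun c => (denseRange_quotientMap μ R).induction_on (p := fun c => ‖c‖ ≤ M + ‖c - b‖) c
    (isClosed_le (by fun_prop) (by fun_prop)) fun f => ?_
  rw [norm_quotientMap]
  refine crossedSeminorm_le fun ρ hρ => ?_
  rw [← ρ.rep.induced_quotientMap μ (R.isRContinuous hρ)]
  refine (norm_le_norm_add_norm_sub' _ _).trans (add_le_add (h ρ hρ) ?_)
  rw [← map_sub]
  exact R.norm_induced_apply_le hρ _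

theorem CrossedProduct.ext {b c : CrossedProduct μ R}
    (h : ∀ ρ, ∀ hρ : ρ ∈ R.carrier, ρ.rep.induced μ (R.isRContinuous hρ) b =
      ρ.rep.induced μ (R.isRContinuous hρ) c) : b = c :=
  sub_eq_zero.1 <| norm_le_zero_iff.1 <| CrossedProduct.norm_le fun ρ hρ => by
    rw [map_sub, h ρ hρ, sub_self, norm_zero]

end Separation

/-! ### The canonical covariant representation -/

/-- The action of `A` on the crossed product that extends pointwise left multiplication on
`C_c(G, A)`. -/
noncomputable def leftMul : A →L[𝕜] (CrossedProduct μ R →L[𝕜] CrossedProduct μ R) :=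
  let P : A →ₗ[𝕜] TwistedConvAlgebra μ R →ₗ[𝕜] TwistedConvAlgebra μ R := pointwiseMul 𝕜 A G
  (BanachCompletion.mapL 𝕜 (TwistedConvAlgebra μ R)).comp
    (P.mkContinuousOfExistsBound₂ (exists_crossedSeminorm_pointwiseMul_le μ R))

theorem leftMul_quotientMap (a : A) (f : C_c(G, A)) :
    leftMul μ R a (quotientMap μ R f) = quotientMap μ R (pointwiseMul 𝕜 A G a f) :=
  BanachCompletion.mapL_of _ _

/-- The action of `G` on the crossed product that extends the translation action on
`C_c(G, A)`. -/
noncomputable def translation : G →* (CrossedProduct μ R →L[𝕜] CrossedProduct μ R) :=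
  let S (r : G) : TwistedConvAlgebra μ R →ₗ[𝕜] TwistedConvAlgebra μ R := α.translate r
  have hS (r : G) : ∃ M : ℝ, ∀ f, ‖S r f‖ ≤ M * ‖f‖ :=
    let ⟨M, _, h⟩ := exists_crossedSeminorm_translate_le μ R (isCompact_singleton (x := r))
    ⟨M, h r rfl⟩
  have hof (r : G) (f : TwistedConvAlgebra μ R) := BanachCompletion.mapL_of
    ((S r).mkContinuousOfExistsBound (hS r)) f
  { toFun := fun r => BanachCompletion.mapL 𝕜 _ ((S r).mkContinuousOfExistsBound (hS r))
    map_one' := BanachCompletion.clm_ext fun f => (hof 1 f).trans <|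
      congrArg BanachCompletion.of (DFunLike.congr_fun (map_one α.translate) f)
    map_mul' := fun r s => BanachCompletion.clm_ext fun f => by
      rw [mul_apply_eq_comp, hof, hof, hof]
      exact congrArg BanachCompletion.of (DFunLike.congr_fun (map_mul α.translate r s) f) }

theorem translation_quotientMap (r : G) (f : C_c(G, A)) :
    translation μ R r (quotientMap μ R f) = quotientMap μ R (α.translate r f) :=
  BanachCompletion.mapL_of _ _

theorem exists_norm_translation_le {K : Set G} (hK : IsCompact K) :
    ∃ M : ℝ, ∀ r ∈ K, ‖translation μ R r‖ ≤ M := by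
  obtain ⟨M, hM₀, hM⟩ := exists_crossedSeminorm_translate_le μ R hK
  refine ⟨M, fun r hr => ContinuousLinearMap.opNorm_le_bound _ hM₀
    (BanachCompletion.norm_clm_apply_le _ fun f => ?_)⟩
  exact (congrArg norm (translation_quotientMap μ R r f)).trans_le <|
    (norm_quotientMap μ R _).trans_le (hM r hr f)

theorem continuous_translation (b : CrossedProduct μ R) :
    Continuous fun r => translation μ R r b := by
  obtain ⟨N, hN, hN₁⟩ := exists_compact_mem_nhds (1 : G)
  obtain ⟨M, hM⟩ := exists_norm_translation_le μ R hN
  refine continuous_clm_of_tendsto_one (Filter.eventually_of_mem hN₁ hM)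
    (dense_span_quotientMap μ R) ?_ b
  rintro _ ⟨f, rfl⟩
  simpa only [translation_quotientMap] using tendsto_quotientMap_translate μ R f

/-- The canonical covariant representation of `(A, G, α)` on the crossed product. -/
noncomputable def canonicalRep : ContCovariantRep α (CrossedProduct μ R) where
  π :=
    { leftMul μ R with
      map_zero' := map_zero (leftMul μ R)
      map_mul' := fun a a' => CrossedProduct.clm_ext fun f => by
        change leftMul μ R (a * a') _ = leftMul μ R a (leftMul μ R a' _)
        simp only [leftMul_quotientMap, pointwiseMul_mul] }
  U := translation μ R
  covariant s a := by
    suffices h : leftMul μ R (α.act s a) * translation μ R s = translation μ R s * leftMul μ R a by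
      change leftMul μ R (α.act s a) = translation μ R s * leftMul μ R a * translation μ R s⁻¹
      rw [← h, mul_assoc, ← map_mul, mul_inv_cancel, map_one, mul_one]
    refine CrossedProduct.clm_ext fun f => ?_
    simp only [mul_apply_eq_comp, leftMul_quotientMap, translation_quotientMap,
      BanachDynamicalSystem.translate_pointwiseMul]
  bounded := ⟨‖leftMul μ R‖, (leftMul μ R).le_opNorm⟩
  continuous := continuous_translation μ R

theorem canonicalRep_π_quotientMap (a : A) (f : C_c(G, A)) :
    (canonicalRep μ R).π a (quotientMap μ R f) = quotientMap μ R (pointwiseMul 𝕜 A G a f) :=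
  leftMul_quotientMap μ R a f

theorem canonicalRep_U_quotientMap (r : G) (f : C_c(G, A)) :
    (canonicalRep μ R).U r (quotientMap μ R f) = quotientMap μ R (α.translate r f) :=
  translation_quotientMap μ R r f

theorem tendsto_canonicalRep_π {l : Filter A} {M : ℝ} (hM : ∀ᶠ u in l, ‖u‖ ≤ M)
    (hl : ∀ a, Tendsto (fun u => u * a) l (𝓝 a)) (b : CrossedProduct μ R) :
    Tendsto (fun u => (canonicalRep μ R).π u b) l (𝓝 b) := by
  refine tendsto_clm_of_dense_span (T := .id 𝕜 _) (M := ‖leftMul μ R‖ * M)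
    (hM.mono fun u hu => (leftMul μ R).le_of_opNorm_le_of_le le_rfl hu)
    (dense_span_quotientMap μ R) ?_ b
  rintro _ ⟨f, rfl⟩
  exact (tendsto_quotientMap_pointwiseMul μ R hM hl f).congr fun u =>
    (canonicalRep_π_quotientMap μ R u f).symm

section Induced

variable {μ R} {X : Type*} [NormedAddCommGroup X] [NormedSpace 𝕜 X] [CompleteSpace X]
  (ρ : ContCovariantRep α X) (h : ρ.IsRContinuous μ R)

theorem ContCovariantRep.induced_canonicalRep_π (a : A) (b : CrossedProduct μ R) :
    ρ.induced μ h ((canonicalRep μ R).π a b) = ρ.π a * ρ.induced μ h b := by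
  refine (denseRange_quotientMap μ R).induction_on (p := fun b =>
    ρ.induced μ h ((canonicalRep μ R).π a b) = ρ.π a * ρ.induced μ h b) b
    (isClosed_eq (by fun_prop) (by fun_prop)) fun f => ?_
  rw [canonicalRep_π_quotientMap, induced_quotientMap, induced_quotientMap,
    integratedForm_pointwiseMul]

theorem ContCovariantRep.induced_canonicalRep_U (s : G) (b : CrossedProduct μ R) :
    ρ.induced μ h ((canonicalRep μ R).U s b) = ρ.U s * ρ.induced μ h b := by
  refine (denseRange_quotientMap μ R).induction_on (p := fun b =>
    ρ.induced μ h ((canonicalRep μ R).U s b) = ρ.U s * ρ.induced μ h b) b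
    (isClosed_eq (by fun_prop) (by fun_prop)) fun f => ?_
  rw [canonicalRep_U_quotientMap, induced_quotientMap, induced_quotientMap,
    integratedForm_translate]

end Induced

theorem canonicalRep_π_mem_leftMultiplierAlgebra (a : A) :
    (canonicalRep μ R).π a ∈ leftMultiplierAlgebra 𝕜 (CrossedProduct μ R) := fun b c =>
  CrossedProduct.ext fun ρ hρ => by
    simp only [ContCovariantRep.induced_mul, ContCovariantRep.induced_canonicalRep_π, mul_assoc]

theorem canonicalRep_U_mem_leftMultiplierAlgebra (s : G) :
    (canonicalRep μ R).U s ∈ leftMultiplierAlgebra 𝕜 (CrossedProduct μ R) := fun b c =>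
  CrossedProduct.ext fun ρ hρ => by
    simp only [ContCovariantRep.induced_mul, ContCovariantRep.induced_canonicalRep_U, mul_assoc]

theorem canonicalRep_integratedForm (f : C_c(G, A)) (b : CrossedProduct μ R) :
    (canonicalRep μ R).integratedForm μ f b = quotientMap μ R f * b :=
  CrossedProduct.ext fun ρ hρ => by
    rw [ContCovariantRep.induced_mul, ContCovariantRep.induced_quotientMap]
    exact ρ.rep.map_integratedForm_apply μ (ρ.rep.induced_canonicalRep_π _)
      (ρ.rep.induced_canonicalRep_U _) f b

theorem exists_norm_quotientMap_bumpTensor_le :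
    ∃ D : ℝ, 0 ≤ D ∧ ∀ᶠ z in bumpFilter μ, ∀ u : A,
      ‖quotientMap μ R (bumpTensor 𝕜 z u)‖ ≤ D * ‖u‖ := by
  obtain ⟨N, hN, hN₁⟩ := exists_compact_mem_nhds (1 : G)
  obtain ⟨D, hD, h⟩ := exists_crossedSeminorm_le_integral μ R hN
  refine ⟨D, hD, Filter.eventually_of_mem (Filter.mem_lift' hN₁) ?_⟩
  rintro z ⟨hz₀, hzN, hz₁⟩ u
  have hnorm : ∀ s, ‖bumpTensor 𝕜 z u s‖ = z s * ‖u‖ := fun s => by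
    rw [bumpTensor_apply, norm_smul, RCLike.norm_ofReal, abs_of_nonneg (hz₀ s)]
  calc ‖quotientMap μ R (bumpTensor 𝕜 z u)‖ = crossedSeminorm μ R (bumpTensor 𝕜 z u) :=
        norm_quotientMap μ R _
    _ ≤ D * ∫ s, ‖bumpTensor 𝕜 z u s‖ ∂μ :=
        h _ fun s hs => by rw [← norm_eq_zero, hnorm, hzN s hs, zero_mul]
    _ = D * ‖u‖ := by simp only [hnorm]; rw [integral_mul_const, hz₁, one_mul]

theorem CrossedProduct.hasBoundedApproxLeftId [μ.IsOpenPosMeasure]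
    (hA : HasBoundedApproxLeftId A) : HasBoundedApproxLeftId (CrossedProduct μ R) := by
  obtain ⟨l, hl, ⟨M, hM⟩, hu⟩ := hA
  obtain ⟨D, hD, hbump⟩ := exists_norm_quotientMap_bumpTensor_le μ R
  refine ⟨(bumpFilter μ ×ˢ l).map fun p => quotientMap μ R (bumpTensor 𝕜 p.1 p.2), inferInstance,
    ⟨D * M, ?_⟩, fun b => ?_⟩
  · rw [Filter.eventually_map]
    filter_upwards [hbump.prod_mk hM] with p hp
    exact (hp.1 p.2).trans (mul_le_mul_of_nonneg_left hp.2 hD)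
  · have hlim := (canonicalRep μ R).tendsto_integratedForm_bumpTensor μ hM
      (tendsto_canonicalRep_π μ R hM hu b)
    simp only [canonicalRep_integratedForm] at hlim
    exact Filter.tendsto_map'_iff.2 hlim

end CrossedProductModule

/-! ### Covariant representations from representations of the crossed product -/

section CovariantExtension

variable {𝕜 A G B X : Type*} [RCLike 𝕜] [NonUnitalNormedRing A] [NormedSpace 𝕜 A] [Group G]
  [TopologicalSpace G] [IsTopologicalGroup G] [LocallyCompactSpace G]
  {α : BanachDynamicalSystem 𝕜 A G} [NonUnitalNormedRing B] [NormedSpace 𝕜 B]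
  [IsScalarTower 𝕜 B B] [CompleteSpace B] [NormedAddCommGroup X] [NormedSpace 𝕜 X]
  [CompleteSpace X] {T : B →L[𝕜] (X →L[𝕜] X)} {κ : ContCovariantRep α B}

/-- The covariant representation on `X` obtained by composing a covariant representation `κ` on `B`
by left multipliers with the extension of a representation of `B` on `X` to left multipliers. -/
noncomputable def IsNondegenerateBoundedRep.covariantRep (hT : IsNondegenerateBoundedRep T)
    (hB : HasBoundedApproxLeftId B) (hπ : ∀ a, κ.π a ∈ leftMultiplierAlgebra 𝕜 B)
    (hU : ∀ s, κ.U s ∈ leftMultiplierAlgebra 𝕜 B) : ContCovariantRep α X :=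
  let E := hT.extension hB
  let i : A →ₙₐ[𝕜] leftMultiplierAlgebra 𝕜 B :=
    { toFun := fun a => ⟨κ.π a, hπ a⟩
      map_smul' := fun c a => Subtype.ext (map_smul κ.π c a)
      map_zero' := Subtype.ext (map_zero κ.π)
      map_add' := fun a b => Subtype.ext (map_add κ.π a b)
      map_mul' := fun a b => Subtype.ext (_root_.map_mul κ.π a b) }
  let j : G →* leftMultiplierAlgebra 𝕜 B := κ.U.codRestrict (leftMultiplierAlgebra 𝕜 B) hU
  { π := (E.toAlgHom : leftMultiplierAlgebra 𝕜 B →ₙₐ[𝕜] (X →L[𝕜] X)).comp i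
    U := (E.toAlgHom : leftMultiplierAlgebra 𝕜 B →* (X →L[𝕜] X)).comp j
    covariant := fun s a => by
      have hij : i (α.act s a) = j s * i a * j s⁻¹ := Subtype.ext (κ.covariant s a)
      change E (i (α.act s a)) = E (j s) * E (i a) * E (j s⁻¹)
      rw [hij, _root_.map_mul, _root_.map_mul]
    bounded := by
      obtain ⟨C, hC⟩ := κ.bounded
      exact ⟨‖E.toContinuousLinearMap‖ * C, fun a => by
        rw [mul_assoc]
        exact E.toContinuousLinearMap.le_of_opNorm_le_of_le le_rfl (hC a)⟩
    continuous := by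
      obtain ⟨N, hN, hN₁⟩ := exists_compact_mem_nhds (1 : G)
      obtain ⟨M, -, hM⟩ := bounded_on_compact κ.continuous hN
      refine continuous_clm_of_tendsto_one (M := ‖E.toContinuousLinearMap‖ * M)
        (Filter.eventually_of_mem hN₁ fun s hs =>
          E.toContinuousLinearMap.le_of_opNorm_le_of_le le_rfl (hM s hs)) hT.dense ?_
      rintro _ ⟨b, x, rfl⟩
      have hE : ∀ s, E (j s) (T b x) = T (κ.U s b) x := fun s =>
        DFunLike.congr_fun (hT.extension_mul hB (j s) b) x
      have hcont : Continuous fun s => T (κ.U s b) x :=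
        (T.continuous.comp (κ.continuous b)).clm_apply continuous_const
      exact (hcont.tendsto' 1 (T b x) (by rw [map_one, one_apply_eq_self])).congr fun s =>
        (hE s).symm }

variable (hT : IsNondegenerateBoundedRep T) (hB : HasBoundedApproxLeftId B)
  (hπ : ∀ a, κ.π a ∈ leftMultiplierAlgebra 𝕜 B) (hU : ∀ s, κ.U s ∈ leftMultiplierAlgebra 𝕜 B)

theorem IsNondegenerateBoundedRep.covariantRep_π_mul (a : A) (b : B) :
    (hT.covariantRep hB hπ hU).π a * T b = T (κ.π a b) :=
  hT.extension_mul hB ⟨κ.π a, hπ a⟩ b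

theorem IsNondegenerateBoundedRep.covariantRep_U_mul (s : G) (b : B) :
    (hT.covariantRep hB hπ hU).U s * T b = T (κ.U s b) :=
  hT.extension_mul hB ⟨κ.U s, hU s⟩ b

end CovariantExtension

section Correspondence

variable {𝕜 A G X : Type*} [RCLike 𝕜] [NonUnitalNormedRing A] [NormedSpace 𝕜 A]
  [IsScalarTower 𝕜 A A] [SMulCommClass 𝕜 A A] [CompleteSpace A] [Group G]
  [TopologicalSpace G] [IsTopologicalGroup G] [LocallyCompactSpace G] [T2Space G]
  [MeasurableSpace G] [BorelSpace G] {α : BanachDynamicalSystem 𝕜 A G}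
  {μ : Measure G} [IsFiniteMeasureOnCompacts μ] [μ.IsMulLeftInvariant]
  {R : UniformlyBoundedClass.{w} α} [NormedAddCommGroup X] [NormedSpace 𝕜 X] [CompleteSpace X]

namespace ContCovariantRep

theorem isNondegenerateBoundedRep_induced [μ.IsOpenPosMeasure] (hA : HasBoundedApproxLeftId A)
    {ρ : ContCovariantRep α X} (h : ρ.IsRContinuous μ R) (hρ : ρ.IsNondegenerate) :
    IsNondegenerateBoundedRep (ρ.induced μ h) := by
  refine ⟨ρ.induced_mul h, fun x => ?_⟩
  obtain ⟨l, hl, ⟨M, hM⟩, hu⟩ := hA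
  exact mem_closure_of_tendsto
    (ρ.tendsto_integratedForm_bumpTensor μ hM (ρ.tendsto_π hρ hM hu x))
    (.of_forall fun p => Submodule.subset_span
      ⟨quotientMap μ R (bumpTensor 𝕜 p.1 p.2), x, by rw [induced_quotientMap]⟩)

theorem eq_of_induced_eq {ρ ρ' : ContCovariantRep α X} {h : ρ.IsRContinuous μ R}
    {h' : ρ'.IsRContinuous μ R} (hT : IsNondegenerateBoundedRep (ρ.induced μ h))
    (heq : ρ.induced μ h = ρ'.induced μ h') : ρ = ρ' := by
  refine ext_of_eq (NonUnitalAlgHom.ext fun a => hT.ext fun b => ?_)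
    (MonoidHom.ext fun s => hT.ext fun b => ?_)
  · rw [← induced_canonicalRep_π, heq, induced_canonicalRep_π]
  · rw [← induced_canonicalRep_U, heq, induced_canonicalRep_U]

end ContCovariantRep

theorem IsNondegenerateBoundedRep.exists_eq_induced [μ.IsOpenPosMeasure]
    (hA : HasBoundedApproxLeftId A) {T : CrossedProduct μ R →L[𝕜] (X →L[𝕜] X)}
    (hT : IsNondegenerateBoundedRep T) :
    ∃ (ρ : ContCovariantRep α X) (h : ρ.IsRContinuous μ R), ρ.IsNondegenerate ∧
      ρ.induced μ h = T := by
  have hB := CrossedProduct.hasBoundedApproxLeftId μ R hA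
  have hπ := canonicalRep_π_mem_leftMultiplierAlgebra μ R
  have hU := canonicalRep_U_mem_leftMultiplierAlgebra μ R
  let ρ := hT.covariantRep hB hπ hU
  have hint : ∀ f, ρ.integratedForm μ f = T (quotientMap μ R f) := fun f => hT.ext fun b => by
    rw [← hT.map_mul, ← canonicalRep_integratedForm]
    exact (ρ.map_integratedForm_apply μ (fun a c => (hT.covariantRep_π_mul hB hπ hU a c).symm)
      (fun s c => (hT.covariantRep_U_mul hB hπ hU s c).symm) f b).symm
  have hρ : ρ.IsRContinuous μ R := ⟨‖T‖, fun f => by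
    rw [hint, ← norm_quotientMap]
    exact T.le_opNorm _⟩
  obtain ⟨l, hl, ⟨M, hM⟩, hu⟩ := hA
  exact ⟨ρ, hρ, hT.dense_of_tendsto (hT.covariantRep_π_mul hB hπ hU)
    (tendsto_canonicalRep_π μ R hM hu), CrossedProduct.clm_ext fun f =>
      (ρ.induced_quotientMap μ hρ f).trans (hint f)⟩

theorem bijOn_induced [μ.IsOpenPosMeasure] (hA : HasBoundedApproxLeftId A) :
    Set.BijOn
      (fun ρ : {ρ : ContCovariantRep α X // ρ.IsRContinuous μ R} => ρ.1.induced μ ρ.2)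
      {ρ | ρ.1.IsNondegenerate} {T | IsNondegenerateBoundedRep T} := by
  have hmaps := fun (ρ : {ρ : ContCovariantRep α X // ρ.IsRContinuous μ R})
    (hρ : ρ.1.IsNondegenerate) => ContCovariantRep.isNondegenerateBoundedRep_induced hA ρ.2 hρ
  refine ⟨hmaps, fun ρ hρ ρ' _ heq => Subtype.ext <|
    ContCovariantRep.eq_of_induced_eq (hmaps ρ hρ) heq, fun T hT => ?_⟩
  obtain ⟨ρ, h, hρ, hρT⟩ := IsNondegenerateBoundedRep.exists_eq_induced hA hT
  exact ⟨⟨ρ, h⟩, hρ, hρT⟩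

variable {A' G' : Type*} [NonUnitalNormedRing A'] [NormedSpace 𝕜 A']
  [IsScalarTower 𝕜 A' A'] [SMulCommClass 𝕜 A' A'] [CompleteSpace A'] [Group G']
  [TopologicalSpace G'] [IsTopologicalGroup G'] [LocallyCompactSpace G'] [T2Space G']
  [MeasurableSpace G'] [BorelSpace G'] {α' : BanachDynamicalSystem 𝕜 A' G'}
  {μ' : Measure G'} [IsFiniteMeasureOnCompacts μ'] [μ'.IsMulLeftInvariant]
  {R' : UniformlyBoundedClass.{w} α'}

namespace ContCovariantRep

theorem commute_induced {ρ : ContCovariantRep α X} (h : ρ.IsRContinuous μ R) {V : X →L[𝕜] X}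
    (hπ : ∀ a, Commute V (ρ.π a)) (hU : ∀ s, Commute V (ρ.U s)) (b : CrossedProduct μ R) :
    Commute V (ρ.induced μ h b) :=
  (denseRange_quotientMap μ R).induction_on (p := fun b => Commute V (ρ.induced μ h b)) b
    (isClosed_eq (by fun_prop) (by fun_prop)) fun f => by
      rw [induced_quotientMap]
      exact ρ.commute_integratedForm μ hπ hU f

theorem commute_induced_iff {ρ : ContCovariantRep α X} {h : ρ.IsRContinuous μ R}
    (hT : IsNondegenerateBoundedRep (ρ.induced μ h)) {V : X →L[𝕜] X} :
    (∀ b, Commute V (ρ.induced μ h b)) ↔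
      (∀ a, Commute V (ρ.π a)) ∧ ∀ s, Commute V (ρ.U s) :=
  ⟨fun hV =>
    ⟨fun a => hT.commute_of_mul_eq hV fun b => (ρ.induced_canonicalRep_π h a b).symm,
      fun s => hT.commute_of_mul_eq hV fun b => (ρ.induced_canonicalRep_U h s b).symm⟩,
    fun ⟨hπ, hU⟩ => commute_induced h hπ hU⟩

theorem commutesWith_iff_commute_induced {ρ : ContCovariantRep α X} {ρ' : ContCovariantRep α' X}
    {h : ρ.IsRContinuous μ R} {h' : ρ'.IsRContinuous μ' R'}
    (hT : IsNondegenerateBoundedRep (ρ.induced μ h))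
    (hT' : IsNondegenerateBoundedRep (ρ'.induced μ' h')) :
    ρ.CommutesWith ρ'.toCovariantRep ↔
      ∀ b b', Commute (ρ.induced μ h b) (ρ'.induced μ' h' b') := by
  have hswap (V : X →L[𝕜] X) : (∀ b, Commute (ρ.induced μ h b) V) ↔
      (∀ a, Commute (ρ.π a) V) ∧ ∀ s, Commute (ρ.U s) V := by
    simpa only [Commute.symm_iff (b := V)] using commute_induced_iff hT (V := V)
  rw [forall_comm]
  simp only [hswap]
  rw [forall_and, forall_comm, forall_comm (β := G)]
  simp only [commute_induced_iff hT', forall_and, CovariantRep.CommutesWith, and_assoc]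

end ContCovariantRep

end Correspondence

theorem bijOn_pi_induced {ι 𝕜 X : Type*} [RCLike 𝕜] {A G : ι → Type*}
    [∀ i, NonUnitalNormedRing (A i)] [∀ i, NormedSpace 𝕜 (A i)]
    [∀ i, IsScalarTower 𝕜 (A i) (A i)] [∀ i, SMulCommClass 𝕜 (A i) (A i)]
    [∀ i, CompleteSpace (A i)]
    [∀ i, Group (G i)] [∀ i, TopologicalSpace (G i)] [∀ i, IsTopologicalGroup (G i)]
    [∀ i, LocallyCompactSpace (G i)] [∀ i, T2Space (G i)]
    [∀ i, MeasurableSpace (G i)] [∀ i, BorelSpace (G i)]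
    {α : ∀ i, BanachDynamicalSystem 𝕜 (A i) (G i)} (hA : ∀ i, HasBoundedApproxLeftId (A i))
    {μ : ∀ i, Measure (G i)} [∀ i, (μ i).IsHaarMeasure]
    {R : ∀ i, UniformlyBoundedClass.{w} (α i)}
    [NormedAddCommGroup X] [NormedSpace 𝕜 X] [CompleteSpace X] :
    Set.BijOn
      (fun (ρ : ∀ i, {ρ : ContCovariantRep (α i) X // ρ.IsRContinuous (μ i) (R i)}) i =>
        (ρ i).1.induced (μ i) (ρ i).2)
      {ρ | (∀ i, (ρ i).1.IsNondegenerate) ∧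
        ∀ i j, i ≠ j → (ρ i).1.CommutesWith (ρ j).1.toCovariantRep}
      {T | (∀ i, IsNondegenerateBoundedRep (T i)) ∧
        ∀ i j, i ≠ j → ∀ b c, Commute (T i b) (T j c)} := by
  have hind i := bijOn_induced (μ := μ i) (R := R i) (X := X) (hA i)
  refine ⟨fun ρ ⟨hρ, hcomm⟩ => ?mapsTo, fun ρ ⟨hρ, _⟩ ρ' ⟨hρ', _⟩ heq => ?injOn,
    fun T ⟨hT, hcomm⟩ => ?surjOn⟩
  case mapsTo =>
    have hT i := (hind i).mapsTo (hρ i)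
    exact ⟨hT, fun i j hij =>
      (ContCovariantRep.commutesWith_iff_commute_induced (hT i) (hT j)).1 (hcomm i j hij)⟩
  case injOn => exact funext fun i => (hind i).injOn (hρ i) (hρ' i) (congrFun heq i)
  case surjOn =>
    choose ρ hρ hρT using fun i => (hind i).surjOn (hT i)
    obtain rfl : (fun i => (ρ i).1.induced (μ i) (ρ i).2) = T := funext hρT
    exact ⟨ρ, ⟨hρ, fun i j hij =>
      (ContCovariantRep.commutesWith_iff_commute_induced (hT i) (hT j)).2 (hcomm i j hij)⟩, rfl⟩

theorem mainTheorem7_general {𝕜 : Type*} [RCLike 𝕜] {n : ℕ}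
    {A : Fin n → Type*} {G : Fin n → Type*}
    [∀ i, NonUnitalNormedRing (A i)] [∀ i, NormedSpace 𝕜 (A i)]
    [∀ i, IsScalarTower 𝕜 (A i) (A i)] [∀ i, SMulCommClass 𝕜 (A i) (A i)]
    [∀ i, CompleteSpace (A i)]
    [∀ i, Group (G i)] [∀ i, TopologicalSpace (G i)] [∀ i, IsTopologicalGroup (G i)]
    [∀ i, LocallyCompactSpace (G i)] [∀ i, T2Space (G i)]
    [∀ i, MeasurableSpace (G i)] [∀ i, BorelSpace (G i)]
    (α : ∀ i, BanachDynamicalSystem 𝕜 (A i) (G i))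
    (hA : ∀ i, HasBoundedApproxLeftId (A i))
    (μ : ∀ i, Measure (G i)) [∀ i, (μ i).IsHaarMeasure]
    (R : ∀ i, UniformlyBoundedClass.{w} (α i))
    {X : Type*} [NormedAddCommGroup X] [NormedSpace 𝕜 X] [CompleteSpace X] :
    Set.BijOn
      (fun ρ : ∀ i, {ρ : ContCovariantRep (α i) X // ρ.IsRContinuous (μ i) (R i)} =>
        (sunProduct fun i => (ρ i).1.induced (μ i) (ρ i).2 :
          ProjTensorProduct 𝕜 (fun i => CrossedProduct (μ i) (R i)) →L[𝕜] (X →L[𝕜] X)))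
      {ρ | (∀ i, (ρ i).1.IsNondegenerate) ∧
        ∀ i j, i ≠ j → (ρ i).1.CommutesWith (ρ j).1.toCovariantRep}
      {T | IsNondegenerateBoundedRep T} := by
  exact (bijOn_sunProduct fun i =>
    CrossedProduct.hasBoundedApproxLeftId (μ i) (R i) (hA i)).comp (bijOn_pi_induced hA)

theorem mainTheorem7 {𝕜 : Type*} [RCLike 𝕜] {n : ℕ}
    {A : Fin n → Type*} {G : Fin n → Type*}
    [∀ i, NonUnitalNormedRing (A i)] [∀ i, NormedSpace 𝕜 (A i)]
    [∀ i, IsScalarTower 𝕜 (A i) (A i)] [∀ i, SMulCommClass 𝕜 (A i) (A i)]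
    [∀ i, CompleteSpace (A i)]
    [∀ i, Group (G i)] [∀ i, TopologicalSpace (G i)] [∀ i, IsTopologicalGroup (G i)]
    [∀ i, LocallyCompactSpace (G i)] [∀ i, T2Space (G i)]
    [∀ i, MeasurableSpace (G i)] [∀ i, BorelSpace (G i)]
    (α : ∀ i, BanachDynamicalSystem 𝕜 (A i) (G i))
    (hA : ∀ i, HasBoundedApproxLeftId (A i))
    (μ : ∀ i, Measure (G i)) [∀ i, (μ i).IsHaarMeasure]
    (R : ∀ i, UniformlyBoundedClass.{w} (α i))
    (hR : ∀ i, ∀ ρ ∈ (R i).carrier, ρ.rep.IsNondegenerate)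
    {X : Type*} [NormedAddCommGroup X] [NormedSpace 𝕜 X] [CompleteSpace X] :
    Set.BijOn
      (fun ρ : ∀ i, {ρ : ContCovariantRep (α i) X // ρ.IsRContinuous (μ i) (R i)} =>
        (sunProduct fun i => (ρ i).1.induced (μ i) (ρ i).2 :
          ProjTensorProduct 𝕜 (fun i => CrossedProduct (μ i) (R i)) →L[𝕜] (X →L[𝕜] X)))
      {ρ | (∀ i, (ρ i).1.IsNondegenerate) ∧
        ∀ i j, i ≠ j → (ρ i).1.CommutesWith (ρ j).1.toCovariantRep}
      {T | IsNondegenerateBoundedRep T} :=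
  mainTheorem7_general α hA μ R
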